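/- **Setting.** Let $J_0\in\mathbb N\cup\{0\}$ and let $\{\psi_{lk}\}$ be a wavelet basis of $L^2([0,1])$, or more generally any orthonormal basis of $L^2([0,1])$ indexed by $(l,k)$ with $l\ge J_0-1$, having $2^l$ elements at each level $l\ge J_0$ and a finite number $K_0$ of elements (the scaling functions) at level $l=J_0-1$. Functions in $L^2([0,1])$ are identified with their coefficient sequences $f_{lk}=\langle f,\psi_{lk}\rangle$. For $s>0$ let $C^s$ be the set of continuous $f:[0,1]\to\mathbb R$ with $\sup_{l,k}2^{l(s+1/2)}|\langle f,\psi_{lk}\rangle|<\infty$. For an increasing sequence $w=(w_l)_{l\ge J_0-1}$, $w_l\ge 1$, let $$\mathcal M_0(w)=\Big\{x=(x_{lk}):\ \|x\|_{\mathcal M(w)}=\sup_l \frac{\max_k|x_{lk}|}{w_l}<\infty,\ \lim_{l\to\infty}\frac{\max_k|x_{lk}|}{w_l}=0\Big\},$$ normed by $\|\cdot\|_{\mathcal M(w)}$; call $w$ admissible if $w_l/\sqrt l\to\infty$ as $l\to\infty$. For probability measures $\mu,\nu$ on a metric space $(S,d)$ put $\beta_S(\mu,\nu)=\sup_{\|F\|_{BL}\le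 1}|\int F\,d\mu-\int F\,d\nu|$, where $\|F\|_{BL}=\sup_x|F(x)|+\sup_{x\ne y}|F(x)-F(y)|/d(x,y)$. Let $\mathbb W=(g_{lk})$ with $g_{lk}$ i.i.d. $N(0,1)$, and let $P^n_f$ be the law of $\mathbb X^{(n)}=f+n^{-1/2}\mathbb W$. **Prior.** Let $\varphi:\mathbb R\to[0,\infty)$ be a probability density with $\varphi(x)\le Ce^{-ax^2}$ for all $x$, for some $a,C>0$; let $\alpha>0$ and $\sigma_l=2^{-l(\alpha+1/2)}$; let $\Pi$ be the law of $\sum_l\sigma_l\sum_k\phi_{lk}\psi_{lk}$ with $\phi_{lk}$ i.i.d. from $\varphi$, and let $\Pi(\cdot\mid\mathbb X^{(n)})$ be the posterior distribution, i.e. the conditional law of $f$ given $\mathbb X^{(n)}$ when $f\sim\Pi$ and $\mathbb X^{(n)}\mid f\sim P^n_f$. **Truth.** Let $f_0\in C^\beta$ for some $\beta>0$, and suppose there are $0<M<\tau$ and $c_\varphi>0$ such that (P1) $\sup_{l,k}|\langle f_0,\psi_{lk}\rangle|/\sigma_l\le M$; (P2) on $(-\tau,\tau)$ the density $\varphi$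 is continuous and satisfies $\varphi\ge c_\varphi$. **Theorem.** For every admissible $w$: $\mathbb W\in\mathcal M_0(w)$ almost surely; for every $n\ge1$, $P^n_{f_0}$-almost surely, $\Pi(\cdot\mid\mathbb X^{(n)})$ is concentrated on $\ell_2\subset\mathcal M_0(w)$ and has a mean $E(f\mid\mathbb X^{(n)})$ (Bochner integral in $\mathcal M_0(w)$). Moreover, if $\mathcal N$ is the law of $\mathbb W$ in $\mathcal M_0(w)$ and $\tilde\Pi_n$ is the image of $\Pi(\cdot\mid\mathbb X^{(n)})$ under $f\mapsto\sqrt n\,(f-T_n)$, then the weak Bernstein–von Mises phenomenon $$\beta_{\mathcal M_0(w)}(\tilde\Pi_n,\mathcal N)\to 0\quad\text{in } P^n_{f_0}\text{-probability as } n\to\infty$$ holds both for $T_n=\mathbb X^{(n)}$ and for $T_n=E(f\mid\mathbb X^{(n)})$. -/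

import Mathlib

open MeasureTheory ProbabilityTheory Filter Topology
open scoped unitInterval ENNReal

noncomputable section

namespace Multiscale

/-! ### Multiscale index set -/

/-- The indices `(l, k)` of a wavelet basis of `L²([0,1])` with coarsest level `J₀`: the `K₀`
scaling functions (`K₀ = 1` for the Haar and the periodised bases with `J₀ = 0`, `K₀ = 2 ^ J₀` for
boundary corrected bases), which are put at level `l = J₀ - 1`, and `2 ^ l` wavelets at each level
`l = J₀ + j ≥ J₀`. -/
abbrev Index (J₀ K₀ : ℕ) : Type := Fin K₀ ⊕ (Σ j : ℕ, Fin (2 ^ (J₀ + j)))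

/-- The level `l` of an index `(l, k)`. -/
def level {J₀ K₀ : ℕ} : Index J₀ K₀ → ℤ
  | Sum.inl _ => (J₀ : ℤ) - 1
  | Sum.inr i => (J₀ : ℤ) + (i.1 : ℤ)

lemma le_level {J₀ K₀ : ℕ} (i : Index J₀ K₀) : (J₀ : ℤ) - 1 ≤ level i := by
  rcases i with i | i <;> simp only [level] <;> omega

/-! ### Weighting sequences and the space `M₀(w)` -/

/-- Monotone increasing weighting sequences `w = (w_l : l ≥ J₀ - 1)` with `w_l ≥ 1`
(the values at `l < J₀ - 1` are never used). -/
structure Weight (J₀ : ℕ) where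
  /-- the sequence -/
  toFun : ℤ → ℝ
  monotoneOn : MonotoneOn toFun (Set.Ici ((J₀ : ℤ) - 1))
  one_le : ∀ l : ℤ, (J₀ : ℤ) - 1 ≤ l → 1 ≤ toFun l

instance (J₀ : ℕ) : CoeFun (Weight J₀) (fun _ => ℤ → ℝ) := ⟨Weight.toFun⟩

/-- Admissible weighting sequences: `w_l / √l → ∞` as `l → ∞`. -/
def Weight.Admissible {J₀ : ℕ} (w : Weight J₀) : Prop :=
  Tendsto (fun l : ℤ => w l / √(l : ℝ)) atTop atTop

lemma Weight.pos {J₀ K₀ : ℕ} (w : Weight J₀) (i : Index J₀ K₀) : 0 < w (level i) :=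
  lt_of_lt_of_le one_pos (w.one_le _ (le_level i))

/-- The sequences `x = (x_{lk})` with `sup_l max_k |x_{lk}| / w_l < ∞` and
`lim_{l → ∞} max_k |x_{lk}| / w_l = 0`, as a linear subspace of the space of all sequences. -/
def M0Submodule {J₀ : ℕ} (K₀ : ℕ) (w : Weight J₀) : Submodule ℝ (Index J₀ K₀ → ℝ) where
  carrier := {x | BddAbove (Set.range fun i => |x i| / w (level i)) ∧
    ∀ ε > 0, ∃ L : ℤ, ∀ i, L ≤ level i → |x i| / w (level i) ≤ ε}
  zero_mem' := by
    refine ⟨⟨0, ?_⟩, fun ε hε => ⟨0, fun i _ => by simpa using hε.le⟩⟩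
    rintro _ ⟨i, rfl⟩
    simp
  add_mem' := by
    have key : ∀ (x y : Index J₀ K₀ → ℝ) (i : Index J₀ K₀), |(x + y) i| / w (level i) ≤
        |x i| / w (level i) + |y i| / w (level i) := by
      intro x y i
      rw [← add_div]
      exact div_le_div_of_nonneg_right (abs_add_le _ _) (w.pos i).le
    rintro x y ⟨⟨a, ha⟩, hx⟩ ⟨⟨b, hb⟩, hy⟩
    refine ⟨⟨a + b, ?_⟩, fun ε hε => ?_⟩
    · rintro _ ⟨i, rfl⟩
      exact (key x y i).trans (add_le_add (ha ⟨i, rfl⟩) (hb ⟨i, rfl⟩))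
    · obtain ⟨L, hL⟩ := hx (ε / 2) (half_pos hε)
      obtain ⟨L', hL'⟩ := hy (ε / 2) (half_pos hε)
      refine ⟨max L L', fun i hi => (key x y i).trans ?_⟩
      have h1 := hL i ((le_max_left _ _).trans hi)
      have h2 := hL' i ((le_max_right _ _).trans hi)
      linarith
  smul_mem' := by
    have key : ∀ (c : ℝ) (x : Index J₀ K₀ → ℝ) (i : Index J₀ K₀), |(c • x) i| / w (level i) =
        |c| * (|x i| / w (level i)) := by
      intro c x i
      rw [Pi.smul_apply, smul_eq_mul, abs_mul, mul_div_assoc]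
    rintro c x ⟨⟨a, ha⟩, hx⟩
    refine ⟨⟨|c| * a, ?_⟩, fun ε hε => ?_⟩
    · rintro _ ⟨i, rfl⟩
      exact (key c x i).trans_le (mul_le_mul_of_nonneg_left (ha ⟨i, rfl⟩) (abs_nonneg c))
    · have hc : (0 : ℝ) < |c| + 1 := by positivity
      obtain ⟨L, hL⟩ := hx (ε / (|c| + 1)) (div_pos hε hc)
      refine ⟨L, fun i hi => (key c x i).trans_le ?_⟩
      calc |c| * (|x i| / w (level i)) ≤ |c| * (ε / (|c| + 1)) :=
            mul_le_mul_of_nonneg_left (hL i hi) (abs_nonneg c)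
        _ ≤ (|c| + 1) * (ε / (|c| + 1)) := by
            apply mul_le_mul_of_nonneg_right _ (div_pos hε hc).le
            linarith
        _ = ε := mul_div_cancel₀ ε hc.ne'

/-- The multiscale space `M₀(w)`. It is a type of its own, so that it carries the topology of the
norm `‖·‖_{M(w)}` below and not the product topology. -/
def M0 {J₀ : ℕ} (K₀ : ℕ) (w : Weight J₀) : Type := M0Submodule K₀ w

section M0

variable {J₀ K₀ : ℕ} {w : Weight J₀}

instance : AddCommGroup (M0 K₀ w) := inferInstanceAs (AddCommGroup (M0Submodule K₀ w))

instance : Module ℝ (M0 K₀ w) := inferInstanceAs (Module ℝ (M0Submodule K₀ w))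

/-- The sequence underlying an element of `M₀(w)`. -/
def M0.coeff (x : M0 K₀ w) : Index J₀ K₀ → ℝ := x.1

lemma M0.bddAbove (x : M0 K₀ w) :
    BddAbove (Set.range fun i => |x.coeff i| / w (level i)) := x.2.1

/-- The norm `‖x‖_{M(w)} = sup_{l,k} |x_{lk}| / w_l`. -/
instance : Norm (M0 K₀ w) := ⟨fun x => ⨆ i, |x.coeff i| / w (level i)⟩

lemma M0.norm_def (x : M0 K₀ w) : ‖x‖ = ⨆ i, |x.coeff i| / w (level i) := rfl

lemma M0.normCore : NormedSpace.Core ℝ (M0 K₀ w) where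
  norm_nonneg x := Real.iSup_nonneg fun i => div_nonneg (abs_nonneg _) (w.pos i).le
  norm_smul c x := by
    rw [M0.norm_def, M0.norm_def, Real.norm_eq_abs, Real.mul_iSup_of_nonneg (abs_nonneg c)]
    congr 1
    funext i
    have h : (c • x).coeff i = c * x.coeff i := rfl
    rw [h, abs_mul, mul_div_assoc]
  norm_triangle x y := by
    refine Real.iSup_le (fun i => ?_) (add_nonneg
      (Real.iSup_nonneg fun i => div_nonneg (abs_nonneg _) (w.pos i).le)
      (Real.iSup_nonneg fun i => div_nonneg (abs_nonneg _) (w.pos i).le))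
    have h : (x + y).coeff i = x.coeff i + y.coeff i := rfl
    rw [h]
    calc |x.coeff i + y.coeff i| / w (level i)
        ≤ |x.coeff i| / w (level i) + |y.coeff i| / w (level i) := by
          rw [← add_div]
          exact div_le_div_of_nonneg_right (abs_add_le _ _) (w.pos i).le
      _ ≤ _ := add_le_add (le_ciSup x.bddAbove i) (le_ciSup y.bddAbove i)
  norm_eq_zero_iff x := by
    constructor
    · intro h
      apply Subtype.ext
      funext i
      have h1 : |x.coeff i| / w (level i) ≤ 0 := (le_ciSup x.bddAbove i).trans_eq h
      have h2 : |x.coeff i| ≤ 0 := by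
        by_contra hne
        exact absurd h1 (not_le.2 (div_pos (not_le.1 hne) (w.pos i)))
      exact abs_nonpos_iff.1 h2
    · rintro rfl
      have h : ∀ i, |(0 : M0 K₀ w).coeff i| / w (level i) = 0 := by
        intro i
        have h0 : (0 : M0 K₀ w).coeff i = 0 := rfl
        rw [h0, abs_zero, zero_div]
      rw [M0.norm_def]
      simp only [h, Real.iSup_const_zero]

instance : NormedAddCommGroup (M0 K₀ w) := NormedAddCommGroup.ofCore M0.normCore

instance : NormedSpace ℝ (M0 K₀ w) := NormedSpace.ofCore M0.normCore

instance : MeasurableSpace (M0 K₀ w) := borel _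

instance : BorelSpace (M0 K₀ w) := ⟨rfl⟩

end M0

open Classical in
/-- A sequence, viewed as an element of `M₀(w)` if it belongs to `M₀(w)`. It is only applied to
random sequences that belong to `M₀(w)` almost surely; the value `0` outside of `M₀(w)` is
immaterial. -/
def toM0 {J₀ K₀ : ℕ} (w : Weight J₀) (x : Index J₀ K₀ → ℝ) : M0 K₀ w :=
  if h : x ∈ M0Submodule K₀ w then ⟨x, h⟩ else 0

/-! ### The bounded Lipschitz metric -/

/-- `‖F‖_{BL} = sup_x |F x| + sup_{x ≠ y} |F x - F y| / d(x, y)`, with values in `[0, ∞]`. -/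
def blNorm {S : Type*} [MetricSpace S] (F : S → ℝ) : ℝ≥0∞ :=
  (⨆ x, ENNReal.ofReal |F x|) +
    ⨆ (x : S) (y : S) (_ : x ≠ y), ENNReal.ofReal (|F x - F y| / dist x y)

/-- `β_S(μ, ν) = sup_{‖F‖_{BL} ≤ 1} |∫ F dμ - ∫ F dν|` for probability measures on `S`. -/
def blDist {S : Type*} [MetricSpace S] [MeasurableSpace S] (μ ν : Measure S) : ℝ :=
  ⨆ F : {F : S → ℝ // blNorm F ≤ 1}, |∫ x, F.1 x ∂μ - ∫ x, F.1 x ∂ν|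

/-! ### The Gaussian white noise model in sequence space -/

/-- The law of a Gaussian white noise `𝕎 = (g_{lk})`, with `g_{lk}` i.i.d. `N(0, 1)`. -/
def whiteNoise (J₀ K₀ : ℕ) : Measure (Index J₀ K₀ → ℝ) :=
  Measure.infinitePi fun _ => gaussianReal 0 1

instance (J₀ K₀ : ℕ) : IsProbabilityMeasure (whiteNoise J₀ K₀) := by
  unfold whiteNoise; infer_instance

/-- The statistical model: `P^n_f` is the law of `𝕏⁽ⁿ⁾ = f + 𝕎 / √n`. -/
def model (J₀ K₀ n : ℕ) : Kernel (Index J₀ K₀ → ℝ) (Index J₀ K₀ → ℝ) where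
  toFun f := (whiteNoise J₀ K₀).map fun g => f + (√(n : ℝ))⁻¹ • g
  measurable' := by
    have h : Measurable fun p : (Index J₀ K₀ → ℝ) × (Index J₀ K₀ → ℝ) =>
        p.1 + (√(n : ℝ))⁻¹ • p.2 := by fun_prop
    refine Measure.measurable_of_measurable_coe _ fun s hs => ?_
    have h1 : ∀ f : Index J₀ K₀ → ℝ,
        ((whiteNoise J₀ K₀).map fun g => f + (√(n : ℝ))⁻¹ • g) s =
        whiteNoise J₀ K₀ (Prod.mk f ⁻¹' ((fun p : (Index J₀ K₀ → ℝ) × (Index J₀ K₀ → ℝ) =>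
          p.1 + (√(n : ℝ))⁻¹ • p.2) ⁻¹' s)) := by
      intro f
      rw [Measure.map_apply (by fun_prop) hs]
      rfl
    simp only [h1]
    exact measurable_measure_prodMk_left (h hs)

lemma model_apply (J₀ K₀ n : ℕ) (f : Index J₀ K₀ → ℝ) :
    model J₀ K₀ n f = (whiteNoise J₀ K₀).map fun g => f + (√(n : ℝ))⁻¹ • g := rfl

instance (J₀ K₀ n : ℕ) : IsMarkovKernel (model J₀ K₀ n) :=
  ⟨fun f => by
    rw [model_apply]
    exact Measure.isProbabilityMeasure_map (by fun_prop)⟩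

/-! ### Product priors -/

/-- Probability densities `φ : ℝ → [0, ∞)` with `φ x ≤ C e^{-a x²}` for all `x`, for some
`a, C > 0`. -/
structure SubGaussianDensity where
  /-- the density -/
  toFun : ℝ → ℝ
  measurable : Measurable toFun
  nonneg : ∀ x, 0 ≤ toFun x
  lintegral_eq_one : ∫⁻ x, ENNReal.ofReal (toFun x) = 1
  subGaussian : ∃ a > 0, ∃ C > 0, ∀ x, toFun x ≤ C * Real.exp (-a * x ^ 2)

instance : CoeFun SubGaussianDensity (fun _ => ℝ → ℝ) := ⟨SubGaussianDensity.toFun⟩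

/-- The probability measure on `ℝ` with density `φ`. -/
def SubGaussianDensity.law (φ : SubGaussianDensity) : Measure ℝ :=
  volume.withDensity fun x => ENNReal.ofReal (φ x)

instance (φ : SubGaussianDensity) : IsProbabilityMeasure φ.law :=
  ⟨by rw [SubGaussianDensity.law, withDensity_apply _ MeasurableSet.univ, Measure.restrict_univ,
    φ.lintegral_eq_one]⟩

/-- The scales `σ_l = 2^{-l (α + 1/2)}`. -/
def priorScale (α : ℝ) (l : ℤ) : ℝ := (2 : ℝ) ^ (-(l : ℝ) * (α + 1 / 2))

/-- The product prior: the law of the coefficient sequence `(σ_l φ_{lk})` of the random function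
`∑_l σ_l ∑_k φ_{lk} ψ_{lk}`, with `φ_{lk}` i.i.d. from the density `φ`. -/
def prior (J₀ K₀ : ℕ) (α : ℝ) (φ : SubGaussianDensity) : Measure (Index J₀ K₀ → ℝ) :=
  (Measure.infinitePi fun _ : Index J₀ K₀ => φ.law).map
    fun x i => priorScale α (level i) * x i

instance (J₀ K₀ : ℕ) (α : ℝ) (φ : SubGaussianDensity) :
    IsProbabilityMeasure (prior J₀ K₀ α φ) :=
  Measure.isProbabilityMeasure_map
    (measurable_pi_lambda _ fun i => (measurable_pi_apply i).const_mul _).aemeasurable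

/-! ### Posterior distributions and the weak Bernstein-von Mises phenomenon -/

section Posterior

variable {J₀ K₀ : ℕ} (Q : Measure (Index J₀ K₀ → ℝ)) [IsProbabilityMeasure Q]

/-- The posterior distribution `Q(· | 𝕏⁽ⁿ⁾ = x)` on sequence space: the conditional law of `f`
given `𝕏⁽ⁿ⁾ = x` when `f ∼ Q` and `𝕏⁽ⁿ⁾ | f ∼ P^n_f`. -/
def post (n : ℕ) (x : Index J₀ K₀ → ℝ) : Measure (Index J₀ K₀ → ℝ) :=
  posterior (model J₀ K₀ n) Q x

/-- The posterior distribution as a measure on `M₀(w)`. -/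
def postM0 (w : Weight J₀) (n : ℕ) (x : Index J₀ K₀ → ℝ) : Measure (M0 K₀ w) :=
  (post Q n x).map (toM0 w)

/-- The posterior mean `E(f | 𝕏⁽ⁿ⁾ = x)`, a Bochner integral in `M₀(w)`. -/
def postMean (w : Weight J₀) (n : ℕ) (x : Index J₀ K₀ → ℝ) : M0 K₀ w :=
  ∫ f, f ∂(postM0 Q w n x)

/-- The weak Bernstein-von Mises phenomenon in `M₀(w)` at `f₀` for the prior `Q`, with centring
`T_n = T_n(𝕏⁽ⁿ⁾)` and limit law `N`: the bounded Lipschitz distance between `N` and the image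
of the posterior under `f ↦ √n (f - T_n)` tends to zero in `P^n_{f₀}`-probability. -/
def WeakBvM (w : Weight J₀) (f₀ : Index J₀ K₀ → ℝ) (T : ℕ → (Index J₀ K₀ → ℝ) → M0 K₀ w)
    (N : Measure (M0 K₀ w)) : Prop :=
  ∀ ε > 0, Tendsto (fun n : ℕ => model J₀ K₀ n f₀
    {x | ε < blDist ((postM0 Q w n x).map fun f => √(n : ℝ) • (f - T n x)) N}) atTop (𝓝 0)

end Posterior

/-! ### Coefficients of functions -/

/-- The coefficients `⟨f, ψ_{lk}⟩ = ∫ f ψ_{lk}` of a continuous function on `[0, 1]` in an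
orthonormal basis of `L²([0, 1])`. -/
def coeffs {J₀ K₀ : ℕ} (ψ : HilbertBasis (Index J₀ K₀) ℝ (Lp ℝ 2 (volume : Measure I)))
    (f : C(I, ℝ)) (i : Index J₀ K₀) : ℝ :=
  inner ℝ (ψ i) (ContinuousMap.toLp 2 (volume : Measure I) ℝ f)

/-- The Hölder-type space `C^s([0,1])` of the continuous functions on `[0, 1]` with
`sup_{l,k} 2^{l (s + 1/2)} |⟨f, ψ_{lk}⟩| < ∞`. -/
def HolderType {J₀ K₀ : ℕ} (ψ : HilbertBasis (Index J₀ K₀) ℝ (Lp ℝ 2 (volume : Measure I)))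
    (s : ℝ) : Set C(I, ℝ) :=
  {f | BddAbove (Set.range fun i => (2 : ℝ) ^ ((level i : ℝ) * (s + 1 / 2)) * |coeffs ψ f i|)}

end Multiscale

end

open Multiscale

/-!
The prior is a product measure and the model acts coordinatewise, so the posterior is the product,
over the indices `(l, k)`, of one-dimensional posteriors (`posterior_productKernel`,
`ae_post_eq_map_localLaw`). A posterior is determined only up to null sets of the marginal law of the
data, while the theorem is about `P^n_{f₀}`. This is harmless: the prior and `f₀` are supported in
`ℓ²`, and shifts of the white noise by square summable sequences have mutually absolutely continuous
laws, by an `L²` bound on the densities of finitely many coordinates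
(`infinitePi_absolutelyContinuous`, `model_absolutelyContinuous_marginal`). The second moment of the
posterior in `ℓ²` gives its concentration on `ℓ²` and the Bochner integrability of the mean.

Write the data as `f₀ + g / √n` with `g` a white noise. The law of the coefficient
`z = √n (f_{lk} - 𝕏_{lk})` under the posterior has density proportional to `φ (m + (g_{lk} + z) / s)`
with respect to `N(0, 1)`, where `m = f₀_{lk} / σ_l` and `s = √n σ_l`. Two facts about these
densities carry the proof.

* For a fixed index `s → ∞`, and the density tends to `1` because `φ` is continuous and positive at
  `m` (`SubGaussianDensity.tendsto_stdDensity`). Hence any finite set of coefficients converges in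
  total variation to independent standard Gaussians.
* The moment `E e^{z²/4}` is bounded on average over `g`, uniformly in `s > 0` and `|m| ≤ M`
  (`SubGaussianDensity.exists_lintegral_exp_sq_le`). Hence a coefficient exceeds `δ w_l` with
  probability at most a constant times `e^{-δ² w_l² / 4}`, and these bounds are summable over all
  indices because `w_l / √l → ∞`, although there are `2 ^ l` indices at level `l`.

A function on `M₀(w)` of bounded Lipschitz norm at most `1` depends only on the coefficients in a
finite set, up to the size of the others relative to the weights (`blDist_map_toM0_le`), so both
facts together give the convergence for the centring at the observation. The two centrings differ,
after rescaling, by the sequence of the means of `z`. By Jensen's inequality and the same two facts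
its norm in `M₀(w)` tends to zero in probability (`tendsto_measure_exists_lt_abs_bias`), and a
translation by `h` changes the bounded Lipschitz distance by at most `‖h‖`.
-/

noncomputable section

namespace Multiscale

/-! ### Infinite products of measures and kernels -/

section Product

variable {ι Ω X : Type*} [MeasurableSpace Ω] [MeasurableSpace X]

lemma lintegral_infinitePi_prod (μ : ι → Measure Ω) [∀ i, IsProbabilityMeasure (μ i)]
    (s : Finset ι) (f : ι → Ω → ℝ≥0∞) (hf : ∀ i, Measurable (f i)) :
    ∫⁻ x, ∏ i ∈ s, f i (x i) ∂Measure.infinitePi μ = ∏ i ∈ s, ∫⁻ y, f i y ∂μ i := by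
  rw [lintegral_prod_eq_prod_lintegral_of_indepFun s (fun i (x : ι → Ω) => f i (x i))
    (iIndepFun_infinitePi hf) (fun i => (hf i).comp (measurable_pi_apply i))]
  refine Finset.prod_congr rfl fun i _ => ?_
  rw [← Measure.infinitePi_map_eval μ i, lintegral_map (hf i) (measurable_pi_apply i)]

/-- The product of a family of Markov kernels, acting coordinatewise:
`x ↦ ⨂ i, κ i (x i)`. -/
def productKernel (κ : ι → Kernel Ω X) [∀ i, IsMarkovKernel (κ i)] : Kernel (ι → Ω) (ι → X) where
  toFun x := Measure.infinitePi fun i => κ i (x i)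
  measurable' := by
    refine Measurable.measure_of_isPiSystem_of_isProbabilityMeasure
      generateFrom_squareCylinders.symm
      (isPiSystem_squareCylinders (fun i => MeasurableSpace.isPiSystem_measurableSet)
        fun i => MeasurableSet.univ) ?_
    rintro _ ⟨s, t, ht, rfl⟩
    have ht' : ∀ i, MeasurableSet (t i) := fun i => ht i (Set.mem_univ i)
    simp_rw [Measure.infinitePi_pi (fun i => _) (s := s) (fun i _ => ht' i)]
    exact Finset.measurable_fun_prod _ fun i _ =>
      ((κ i).measurable_coe (ht' i)).comp (measurable_pi_apply i)

lemma productKernel_apply (κ : ι → Kernel Ω X) [∀ i, IsMarkovKernel (κ i)] (x : ι → Ω) :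
    productKernel κ x = Measure.infinitePi fun i => κ i (x i) := rfl

instance (κ : ι → Kernel Ω X) [∀ i, IsMarkovKernel (κ i)] : IsMarkovKernel (productKernel κ) :=
  ⟨fun x => by rw [productKernel_apply]; infer_instance⟩

/-- The joint law of a product measure and a product kernel is the product of the coordinatewise
joint laws. -/
lemma infinitePi_compProd_productKernel (μ : ι → Measure Ω) [∀ i, IsProbabilityMeasure (μ i)]
    (κ : ι → Kernel Ω X) [∀ i, IsMarkovKernel (κ i)] :
    Measure.infinitePi μ ⊗ₘ productKernel κ =
      (Measure.infinitePi fun i => μ i ⊗ₘ κ i).map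
        fun p => (fun i => (p i).1, fun i => (p i).2) := by
  have h : (Measure.infinitePi μ ⊗ₘ productKernel κ).map (fun p i => (p.1 i, p.2 i)) =
      Measure.infinitePi fun i => μ i ⊗ₘ κ i := by
    refine Measure.eq_infinitePi _ fun s t ht => ?_
    have hm : Measurable fun (p : (ι → Ω) × (ι → X)) (i : ι) => (p.1 i, p.2 i) := by fun_prop
    have hst : MeasurableSet ((s : Set ι).pi t) :=
      MeasurableSet.pi s.countable_toSet fun i _ => ht i
    rw [Measure.map_apply hm hst, Measure.compProd_apply (hm hst)]
    have h1 : ∀ x : ι → Ω, productKernel κ x (Prod.mk x ⁻¹' ((fun p i => (p.1 i, p.2 i)) ⁻¹'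
        ((s : Set ι).pi t))) = ∏ i ∈ s, κ i (x i) (Prod.mk (x i) ⁻¹' t i) := by
      intro x
      rw [← Measure.infinitePi_pi (fun i => κ i (x i))
        (fun i _ => measurable_prodMk_left (ht i)), productKernel_apply]
      rfl
    simp_rw [h1]
    rw [lintegral_infinitePi_prod μ s (fun i y => κ i y (Prod.mk y ⁻¹' t i))
      fun i => Kernel.measurable_kernel_prodMk_left (ht i)]
    exact Finset.prod_congr rfl fun i _ => (Measure.compProd_apply (ht i)).symm
  rw [← h, Measure.map_map (by fun_prop) (by fun_prop)]
  exact Measure.map_id.symm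

/-- The posterior of a product prior in a product model is the product of the coordinatewise
posteriors `ν i`. -/
theorem posterior_productKernel [Countable ι] [StandardBorelSpace Ω] [Nonempty Ω]
    (μ : ι → Measure Ω) [∀ i, IsProbabilityMeasure (μ i)]
    (κ : ι → Kernel Ω X) [∀ i, IsMarkovKernel (κ i)] (ν : ι → Kernel X Ω)
    [∀ i, IsMarkovKernel (ν i)]
    (h : ∀ i, (κ i ∘ₘ μ i) ⊗ₘ ν i = (μ i ⊗ₘ κ i).map Prod.swap) :
    productKernel ν =ᵐ[productKernel κ ∘ₘ Measure.infinitePi μ]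
      posterior (productKernel κ) (Measure.infinitePi μ) := by
  refine ae_eq_posterior_of_compProd_eq ?_
  have h1 : productKernel κ ∘ₘ Measure.infinitePi μ = Measure.infinitePi fun i => κ i ∘ₘ μ i := by
    rw [← Measure.snd_compProd, infinitePi_compProd_productKernel, Measure.snd,
      Measure.map_map measurable_snd (by fun_prop)]
    simp_rw [← Measure.snd_compProd]
    exact Measure.infinitePi_map_pi _ fun i => measurable_snd
  rw [h1, infinitePi_compProd_productKernel, infinitePi_compProd_productKernel]
  simp_rw [h]
  rw [← Measure.infinitePi_map_pi _ (fun i => measurable_swap),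
    Measure.map_map (by fun_prop) (by fun_prop), Measure.map_map (by fun_prop) (by fun_prop)]
  rfl

/-- Changing finitely many factors of a product measure by densities amounts to multiplying it
by the product of these densities. -/
lemma infinitePi_withDensity_finset [DecidableEq ι] (μ ν : ι → Measure Ω)
    [∀ i, IsProbabilityMeasure (μ i)]
    [∀ i, IsProbabilityMeasure (ν i)] (r : ι → Ω → ℝ≥0∞) (hr : ∀ i, Measurable (r i))
    (h : ∀ i, ν i = (μ i).withDensity (r i)) (s : Finset ι)
    [∀ i, IsProbabilityMeasure (s.piecewise ν μ i)] :
    (Measure.infinitePi μ).withDensity (fun x => ∏ i ∈ s, r i (x i)) =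
      Measure.infinitePi (s.piecewise ν μ) := by
  refine Measure.eq_infinitePi _ fun u t ht => ?_
  have hut : MeasurableSet ((u : Set ι).pi t) :=
    MeasurableSet.pi u.countable_toSet fun i _ => ht i
  rw [withDensity_apply _ hut, ← lintegral_indicator hut]
  have h1 : ∀ x : ι → Ω, ((u : Set ι).pi t).indicator (fun x => ∏ i ∈ s, r i (x i)) x =
      ∏ i ∈ s ∪ u, ((if i ∈ s then r i (x i) else 1) *
        (if i ∈ u then (t i).indicator 1 (x i) else 1)) := by
    intro x
    rw [Finset.prod_mul_distrib, Finset.prod_ite_mem, Finset.prod_ite_mem,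
      Finset.union_inter_cancel_left, Finset.union_inter_cancel_right]
    by_cases hx : x ∈ (u : Set ι).pi t
    · rw [Set.indicator_of_mem hx, Finset.prod_eq_one (s := u), mul_one]
      intro i hi
      rw [Set.indicator_of_mem (hx i hi)]; rfl
    · rw [Set.indicator_of_notMem hx]
      simp only [Set.mem_pi, not_forall] at hx
      obtain ⟨i, hi, hxi⟩ := hx
      rw [Finset.prod_eq_zero (s := u) (i := i) hi (Set.indicator_of_notMem hxi _), mul_zero]
  simp_rw [h1]
  have hm : ∀ i, Measurable fun y => (if i ∈ s then r i y else 1) *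
      (if i ∈ u then (t i).indicator (1 : Ω → ℝ≥0∞) y else 1) := by
    intro i
    refine Measurable.mul ?_ ?_
    · split_ifs
      exacts [hr i, measurable_const]
    · split_ifs
      exacts [measurable_one.indicator (ht i), measurable_const]
  rw [lintegral_infinitePi_prod μ (s ∪ u) _ hm]
  have h2 : ∀ i, ∫⁻ y, (if i ∈ s then r i y else 1) *
      (if i ∈ u then (t i).indicator (1 : Ω → ℝ≥0∞) y else 1) ∂μ i =
      if i ∈ u then s.piecewise ν μ i (t i) else 1 := by
    intro i
    have h3 : ∫⁻ y, r i y ∂μ i = 1 := by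
      have := measure_univ (μ := ν i)
      rwa [h i, withDensity_apply _ MeasurableSet.univ, Measure.restrict_univ] at this
    by_cases hs : i ∈ s <;> by_cases hu : i ∈ u <;>
      simp only [hs, hu, if_true, if_false, Finset.piecewise, mul_one, one_mul]
    · rw [h i, withDensity_apply _ (ht i), ← lintegral_indicator (ht i)]
      refine lintegral_congr fun y => ?_
      by_cases hy : y ∈ t i <;> simp [hy]
    · exact h3
    · rw [lintegral_indicator_one (ht i)]
    · simp
  simp_rw [h2]
  rw [Finset.prod_ite_mem, Finset.union_inter_cancel_right]

lemma infinitePi_piecewise_preimage_cylinder [DecidableEq ι] (μ ν : ι → Measure Ω)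
    [∀ i, IsProbabilityMeasure (μ i)] [∀ i, IsProbabilityMeasure (ν i)] (s : Finset ι)
    [∀ i, IsProbabilityMeasure (s.piecewise ν μ i)] :
    (Measure.infinitePi (s.piecewise ν μ)).map s.restrict =
      (Measure.infinitePi ν).map s.restrict := by
  rw [Measure.infinitePi_map_restrict, Measure.infinitePi_map_restrict]
  congr 1
  funext i
  simp

/-- A criterion for absolute continuity of product measures: the densities `r i` of the factors
have uniformly bounded products of second moments. A cylinder `B` then satisfies
`ν B ≤ t K + μ B / t` for all `t > 0`, since `r ≤ t r² + 1 / t`, and cylinders approximate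
measurable sets. -/
theorem infinitePi_absolutelyContinuous (μ ν : ι → Measure Ω) [∀ i, IsProbabilityMeasure (μ i)]
    [∀ i, IsProbabilityMeasure (ν i)] (r : ι → Ω → ℝ≥0∞) (hr : ∀ i, Measurable (r i))
    (h : ∀ i, ν i = (μ i).withDensity (r i)) (K : ℝ≥0∞) (hK : K ≠ ∞)
    (hrK : ∀ s : Finset ι, ∏ i ∈ s, ∫⁻ y, r i y ^ 2 ∂μ i ≤ K) :
    Measure.infinitePi ν ≪ Measure.infinitePi μ := by
  classical
  have key : ∀ B ∈ measurableCylinders fun _ : ι => Ω, ∀ t : ℝ≥0∞, t ≠ 0 → t ≠ ∞ →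
      Measure.infinitePi ν B ≤ t * K + t⁻¹ * Measure.infinitePi μ B := by
    intro B hB t ht0 ht
    obtain ⟨s, S, hS, hBS⟩ := (mem_measurableCylinders B).1 hB
    have hpr : ∀ i, IsProbabilityMeasure (s.piecewise ν μ i) := fun i => by
      by_cases hi : i ∈ s <;> simp only [hi, Finset.piecewise, if_true, if_false] <;> infer_instance
    have hcyl : MeasurableSet B := MeasurableSet.of_mem_measurableCylinders hB
    have h1 : Measure.infinitePi ν (B) =
        ∫⁻ x in B, ∏ i ∈ s, r i (x i) ∂Measure.infinitePi μ := by
      rw [← withDensity_apply _ hcyl, infinitePi_withDensity_finset μ ν r hr h s, hBS, cylinder,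
        ← Measure.map_apply (Finset.measurable_restrict s) hS,
        ← Measure.map_apply (Finset.measurable_restrict s) hS,
        infinitePi_piecewise_preimage_cylinder]
    have h2 : ∀ y : ℝ≥0∞, y ≤ t * y ^ 2 + t⁻¹ := by
      intro y
      rcases le_total y t⁻¹ with hy | hy
      · exact hy.trans le_add_self
      · refine le_trans ?_ le_self_add
        calc y = (t * t⁻¹) * y := by rw [ENNReal.mul_inv_cancel ht0 ht, one_mul]
          _ ≤ (t * y) * y := by gcongr
          _ = t * y ^ 2 := by ring
    have hmeas : Measurable fun x : ι → Ω => ∏ i ∈ s, r i (x i) :=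
      Finset.measurable_fun_prod _ fun i _ => (hr i).comp (measurable_pi_apply i)
    rw [h1]
    calc ∫⁻ x in B, ∏ i ∈ s, r i (x i) ∂Measure.infinitePi μ
        ≤ ∫⁻ x in B, (t * (∏ i ∈ s, r i (x i)) ^ 2 + t⁻¹) ∂Measure.infinitePi μ :=
          lintegral_mono fun x => h2 _
      _ = t * (∫⁻ x in B, (∏ i ∈ s, r i (x i)) ^ 2 ∂Measure.infinitePi μ) +
          t⁻¹ * Measure.infinitePi μ (B) := by
          rw [lintegral_add_right _ measurable_const, lintegral_const_mul _ (hmeas.pow_const 2),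
            lintegral_const, Measure.restrict_apply_univ]
      _ ≤ t * (∫⁻ x, (∏ i ∈ s, r i (x i)) ^ 2 ∂Measure.infinitePi μ) +
          t⁻¹ * Measure.infinitePi μ (B) := by
          gcongr
          exact Measure.restrict_le_self
      _ ≤ _ := by
          gcongr
          simp_rw [← Finset.prod_pow]
          rw [lintegral_infinitePi_prod μ s (fun i y => r i y ^ 2) fun i => (hr i).pow_const 2]
          exact hrK s
  refine Measure.AbsolutelyContinuous.mk fun A hA hA0 => ?_
  have hall : ∀ t : ℝ≥0∞, t ≠ 0 → t ≠ ∞ → Measure.infinitePi ν A ≤ t * K := by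
    intro t ht0 ht
    refine ENNReal.le_of_forall_pos_le_add fun ε hε _ => ?_
    -- the cylinder has to be good enough for `η / t + η ≤ ε`
    obtain ⟨η, hη0, hη⟩ : ∃ η : ℝ≥0∞, 0 < η ∧ t⁻¹ * η + η ≤ ε := by
      refine ⟨ε / (t⁻¹ + 1), ?_, ?_⟩
      · exact ENNReal.div_pos (by exact_mod_cast hε.ne') (by simp [ht0])
      · rw [← add_one_mul, ENNReal.mul_div_cancel (by simp) (by simp [ht0])]
    obtain ⟨B, hB, hBA⟩ := exists_measure_symmDiff_lt_of_generateFrom_isSetRing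
      (μ := Measure.infinitePi ν + Measure.infinitePi μ)
      (isSetRing_measurableCylinders (α := fun _ : ι => Ω))
      ⟨{Set.univ}, Set.countable_singleton _, by
        simpa using univ_mem_measurableCylinders (fun _ : ι => Ω), by simp⟩
      generateFrom_measurableCylinders.symm hA hη0
    rw [Measure.add_apply] at hBA
    have hν : Measure.infinitePi ν (symmDiff B A) ≤ η := le_self_add.trans hBA.le
    have hμ : Measure.infinitePi μ (symmDiff B A) ≤ η := le_add_self.trans hBA.le
    have hB1 : Measure.infinitePi μ B ≤ η := by
      calc Measure.infinitePi μ B ≤ Measure.infinitePi μ (A ∪ symmDiff B A) :=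
            measure_mono fun x hx => by
              by_cases hxA : x ∈ A
              · exact Or.inl hxA
              · exact Or.inr (Or.inl ⟨hx, hxA⟩)
        _ ≤ _ := measure_union_le _ _
        _ ≤ η := by rw [hA0, zero_add]; exact hμ
    calc Measure.infinitePi ν A ≤ Measure.infinitePi ν (B ∪ symmDiff B A) :=
          measure_mono fun x hx => by
            by_cases hxB : x ∈ B
            · exact Or.inl hxB
            · exact Or.inr (Or.inr ⟨hx, hxB⟩)
      _ ≤ Measure.infinitePi ν B + Measure.infinitePi ν (symmDiff B A) := measure_union_le _ _
      _ ≤ (t * K + t⁻¹ * η) + η := by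
          refine add_le_add ((key B hB t ht0 ht).trans ?_) hν
          gcongr
      _ ≤ t * K + ε := by rw [add_assoc]; gcongr
  refine le_antisymm ?_ zero_le
  refine ENNReal.le_of_forall_pos_le_add fun ε hε _ => ?_
  rw [zero_add]
  rcases eq_or_ne K 0 with hK0 | hK0
  · exact (hall 1 one_ne_zero ENNReal.one_ne_top).trans (by simp [hK0])
  · have := hall (ε / K) (ENNReal.div_pos (by exact_mod_cast hε.ne') hK).ne'
      (ENNReal.div_ne_top ENNReal.coe_ne_top hK0)
    rwa [ENNReal.div_mul_cancel hK0 hK] at this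

end Product

/-! ### Shifts of the white noise -/

/-- The density of `N(a, 1)` with respect to `N(0, 1)`. -/
def shiftDensity (a z : ℝ) : ℝ≥0∞ := ENNReal.ofReal (Real.exp (a * z - a ^ 2 / 2))

lemma measurable_shiftDensity (a : ℝ) : Measurable (shiftDensity a) := by
  unfold shiftDensity; fun_prop

lemma gaussianReal_eq_withDensity_shiftDensity (a : ℝ) :
    gaussianReal a 1 = (gaussianReal 0 1).withDensity (shiftDensity a) := by
  rw [gaussianReal_of_var_ne_zero _ one_ne_zero, gaussianReal_of_var_ne_zero _ one_ne_zero,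
    ← withDensity_mul _ (measurable_gaussianPDF 0 1) (measurable_shiftDensity a)]
  congr 1
  funext z
  rw [Pi.mul_apply, gaussianPDF, gaussianPDF, shiftDensity,
    ← ENNReal.ofReal_mul (gaussianPDFReal_nonneg _ _ _)]
  congr 1
  simp only [gaussianPDFReal]
  conv_rhs => rw [mul_assoc, ← Real.exp_add]
  congr 2
  simp only [NNReal.coe_one]
  ring

lemma lintegral_exp_mul_gaussianReal (t : ℝ) :
    ∫⁻ z, ENNReal.ofReal (Real.exp (t * z)) ∂gaussianReal 0 1 =
      ENNReal.ofReal (Real.exp (t ^ 2 / 2)) := by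
  have h := mgf_gaussianReal (p := gaussianReal 0 1) (X := id) (μ := 0) (v := 1)
    Measure.map_id t
  have h1 : Integrable (fun z => Real.exp (t * z)) (gaussianReal 0 1) :=
    integrable_exp_mul_gaussianReal t
  rw [← ofReal_integral_eq_lintegral_ofReal h1 (ae_of_all _ fun z => (Real.exp_pos _).le)]
  congr 1
  rw [mgf] at h
  simpa using h

lemma lintegral_shiftDensity_sq (a : ℝ) :
    ∫⁻ z, shiftDensity a z ^ 2 ∂gaussianReal 0 1 = ENNReal.ofReal (Real.exp (a ^ 2)) := by
  have h : ∀ z, shiftDensity a z ^ 2 =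
      ENNReal.ofReal (Real.exp (-a ^ 2)) * ENNReal.ofReal (Real.exp ((2 * a) * z)) := by
    intro z
    rw [shiftDensity, ← ENNReal.ofReal_pow (Real.exp_pos _).le,
      ← ENNReal.ofReal_mul (Real.exp_pos _).le, ← Real.exp_nat_mul, ← Real.exp_add]
    congr 2
    push_cast
    ring
  simp_rw [h]
  rw [lintegral_const_mul _ (by fun_prop), lintegral_exp_mul_gaussianReal,
    ← ENNReal.ofReal_mul (Real.exp_pos _).le, ← Real.exp_add]
  congr 2
  ring

/-- The law of the white noise shifted by a square summable sequence is absolutely continuous with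
respect to the law of the white noise. -/
theorem whiteNoise_shift_absolutelyContinuous {J₀ K₀ : ℕ} (a : Index J₀ K₀ → ℝ)
    (ha : Summable fun i => a i ^ 2) :
    (whiteNoise J₀ K₀).map (fun g => a + g) ≪ whiteNoise J₀ K₀ := by
  have h1 : (whiteNoise J₀ K₀).map (fun g => a + g) =
      Measure.infinitePi fun i => gaussianReal (a i) 1 := by
    have h := Measure.infinitePi_map_pi (fun _ : Index J₀ K₀ => gaussianReal 0 1)
      (f := fun i z => a i + z) fun i => by fun_prop
    simp_rw [gaussianReal_map_const_add, zero_add] at h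
    exact h
  rw [h1, whiteNoise]
  refine infinitePi_absolutelyContinuous _ _ (fun i => shiftDensity (a i))
    (fun i => measurable_shiftDensity _) (fun i => gaussianReal_eq_withDensity_shiftDensity _)
    (ENNReal.ofReal (Real.exp (∑' i, a i ^ 2))) ENNReal.ofReal_ne_top fun s => ?_
  simp_rw [lintegral_shiftDensity_sq]
  rw [← ENNReal.ofReal_prod_of_nonneg fun i _ => (Real.exp_pos _).le, ← Real.exp_sum]
  exact ENNReal.ofReal_le_ofReal (Real.exp_le_exp.2 (ha.sum_le_tsum s fun i _ => sq_nonneg _))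

/-- If `f` and `f'` differ by a square summable sequence, then `P^n_f ≪ P^n_{f'}`. -/
theorem model_absolutelyContinuous {J₀ K₀ n : ℕ} (hn : 1 ≤ n) (f f' : Index J₀ K₀ → ℝ)
    (h : Summable fun i => (f i - f' i) ^ 2) : model J₀ K₀ n f ≪ model J₀ K₀ n f' := by
  have hn0 : √(n : ℝ) ≠ 0 := (Real.sqrt_pos.2 (by exact_mod_cast hn)).ne'
  have h1 : Summable fun i => (√(n : ℝ) • (f - f')) i ^ 2 := by
    simp only [Pi.smul_apply, Pi.sub_apply, smul_eq_mul, mul_pow]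
    exact h.mul_left _
  have h2 : Measurable fun g : Index J₀ K₀ → ℝ => f' + (√(n : ℝ))⁻¹ • g := by fun_prop
  have h3 := (whiteNoise_shift_absolutelyContinuous _ h1).map h2
  rw [Measure.map_map h2 (by fun_prop)] at h3
  rw [model_apply, model_apply]
  convert h3 using 2
  funext g
  simp only [Function.comp_apply, smul_add, smul_smul, inv_mul_cancel₀ hn0, one_smul]
  abel

/-! ### The posterior of one coefficient -/

section Coordinate

variable (h : ℝ → ℝ≥0∞) (c : ℝ)

/-- The law of the observation `θ + c z`, with `z` standard Gaussian, as a kernel in `θ`. -/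
def coordModel : Kernel ℝ ℝ :=
  (Kernel.id ×ₖ Kernel.const ℝ (gaussianReal 0 1)).map fun p => p.1 + c * p.2

instance : IsMarkovKernel (coordModel c) := by
  unfold coordModel
  exact Kernel.IsMarkovKernel.map _ (by fun_prop)

lemma coordModel_apply (θ : ℝ) :
    coordModel c θ = (gaussianReal 0 1).map fun z => θ + c * z := by
  rw [coordModel, Kernel.map_apply _ (by fun_prop), Kernel.prod_apply, Kernel.id_apply,
    Kernel.const_apply, Measure.dirac_prod, Measure.map_map (by fun_prop) (by fun_prop)]
  rfl

/-- The marginal density at `x` of the observation `θ + c z`, when `θ` has density `h`. -/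
def evidence (x : ℝ) : ℝ≥0∞ := ∫⁻ z, h (x + c * z) ∂gaussianReal 0 1

/-- The posterior density, with respect to `N(0, 1)`, of the rescaled parameter `z = (θ - x) / c`
given the observation `x`, when `θ` has prior density `h`. -/
def localDensity (x z : ℝ) : ℝ≥0∞ := h (x + c * z) / evidence h c x

variable {h}

lemma measurable_evidence (hh : Measurable h) : Measurable (evidence h c) := by
  unfold evidence
  exact Measurable.lintegral_prod_right' (f := fun p : ℝ × ℝ => h (p.1 + c * p.2)) (by fun_prop)

lemma measurable_localDensity (hh : Measurable h) :
    Measurable (Function.uncurry (localDensity h c)) := by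
  have := measurable_evidence c hh
  unfold localDensity Function.uncurry
  fun_prop

lemma lintegral_localDensity {x : ℝ} (hh : Measurable h) (h0 : evidence h c x ≠ 0)
    (h1 : evidence h c x ≠ ∞) : ∫⁻ z, localDensity h c x z ∂gaussianReal 0 1 = 1 := by
  simp_rw [localDensity, div_eq_mul_inv]
  rw [lintegral_mul_const _ (by fun_prop)]
  exact ENNReal.mul_inv_cancel h0 h1

variable (h) in
/-- The posterior law of the rescaled parameter `z = (θ - x) / c` given the observation `x`. -/
def localPost : Kernel ℝ ℝ :=
  (Kernel.const ℝ (gaussianReal 0 1)).withDensity (localDensity h c)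

lemma localPost_apply (hh : Measurable h) (x : ℝ) :
    localPost h c x = (gaussianReal 0 1).withDensity (localDensity h c x) := by
  rw [localPost, Kernel.withDensity_apply _ (measurable_localDensity c hh), Kernel.const_apply]

lemma isMarkovKernel_localPost (hh : Measurable h) (h0 : ∀ x, evidence h c x ≠ 0)
    (h1 : ∀ x, evidence h c x ≠ ∞) : IsMarkovKernel (localPost h c) :=
  ⟨fun x => ⟨by
    rw [localPost_apply c hh, withDensity_apply _ MeasurableSet.univ, Measure.restrict_univ,
      lintegral_localDensity c hh (h0 x) (h1 x)]⟩⟩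

variable (h) in
/-- The posterior law of the parameter `θ` given the observation `x`. -/
def coordPost : Kernel ℝ ℝ :=
  (Kernel.id ×ₖ localPost h c).map fun p => p.1 + c * p.2

lemma coordPost_apply [IsMarkovKernel (localPost h c)] (x : ℝ) :
    coordPost h c x = (localPost h c x).map fun z => x + c * z := by
  rw [coordPost, Kernel.map_apply _ (by fun_prop), Kernel.prod_apply, Kernel.id_apply,
    Measure.dirac_prod, Measure.map_map (by fun_prop) (by fun_prop)]
  rfl

instance [IsMarkovKernel (localPost h c)] : IsMarkovKernel (coordPost h c) := by
  unfold coordPost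
  exact Kernel.IsMarkovKernel.map _ (by fun_prop)

/-- Bayes' formula for one coefficient. -/
theorem coordPost_compProd (hh : Measurable h) (h0 : ∀ x, evidence h c x ≠ 0)
    (h1 : ∀ x, evidence h c x ≠ ∞) [IsMarkovKernel (localPost h c)]
    [IsProbabilityMeasure (volume.withDensity h)] :
    (coordModel c ∘ₘ volume.withDensity h) ⊗ₘ coordPost h c =
      (volume.withDensity h ⊗ₘ coordModel c).map Prod.swap := by
  have hev := measurable_evidence c hh
  have key : volume.withDensity (evidence h c) ⊗ₘ coordPost h c =
      (volume.withDensity h ⊗ₘ coordModel c).map Prod.swap := by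
    refine Measure.ext_of_lintegral _ fun F hF => ?_
    rw [lintegral_map hF measurable_swap, Measure.lintegral_compProd hF,
      Measure.lintegral_compProd (by fun_prop)]
    simp_rw [coordPost_apply, coordModel_apply]
    have hld : ∀ x, Measurable (localDensity h c x) := fun x =>
      (measurable_localDensity c hh).comp measurable_prodMk_left
    have e1 : ∀ x, ∫⁻ θ, F (x, θ) ∂(localPost h c x).map (fun z => x + c * z) =
        ∫⁻ z, localDensity h c x z * F (x, x + c * z) ∂gaussianReal 0 1 := by
      intro x
      rw [lintegral_map (by fun_prop) (by fun_prop), localPost_apply c hh,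
        lintegral_withDensity_eq_lintegral_mul _ (hld x)
          (by fun_prop)]
      rfl
    have e2 : ∀ θ, ∫⁻ x, F (Prod.swap (θ, x)) ∂(gaussianReal 0 1).map (fun z => θ + c * z) =
        ∫⁻ z, F (θ - c * z, θ) ∂gaussianReal 0 1 := by
      intro θ
      have e3 : gaussianReal 0 1 = (gaussianReal 0 1).map fun z => -z := by
        rw [gaussianReal_map_neg, neg_zero]
      rw [lintegral_map (by fun_prop) (by fun_prop)]
      conv_lhs => rw [e3]
      rw [lintegral_map (by fun_prop) (by fun_prop)]
      refine lintegral_congr fun z => ?_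
      rw [Prod.swap_prod_mk, mul_neg, ← sub_eq_add_neg]
    simp_rw [e1, e2]
    have hm2 : Measurable fun p : ℝ × ℝ => localDensity h c p.1 p.2 * F (p.1, p.1 + c * p.2) :=
      (measurable_localDensity c hh).mul (by fun_prop)
    rw [lintegral_withDensity_eq_lintegral_mul _ hev hm2.lintegral_prod_right',
      lintegral_withDensity_eq_lintegral_mul _ hh
        (Measurable.lintegral_prod_right' (f := fun p : ℝ × ℝ => F (p.1 - c * p.2, p.1))
          (by fun_prop))]
    simp only [Pi.mul_apply]
    have e4 : ∀ x, evidence h c x *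
        ∫⁻ z, localDensity h c x z * F (x, x + c * z) ∂gaussianReal 0 1 =
        ∫⁻ z, h (x + c * z) * F (x, x + c * z) ∂gaussianReal 0 1 := by
      intro x
      have hm3 : Measurable fun z => localDensity h c x z * F (x, x + c * z) :=
        (hld x).mul (by fun_prop)
      rw [← lintegral_const_mul _ hm3]
      refine lintegral_congr fun z => ?_
      rw [← mul_assoc, localDensity, ENNReal.mul_div_cancel (h0 x) (h1 x)]
    have e5 : ∀ θ, h θ * ∫⁻ z, F (θ - c * z, θ) ∂gaussianReal 0 1 =
        ∫⁻ z, h θ * F (θ - c * z, θ) ∂gaussianReal 0 1 := fun θ =>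
      (lintegral_const_mul _ (by fun_prop)).symm
    simp_rw [e4, e5]
    conv_lhs => rw [lintegral_lintegral_swap (by fun_prop)]
    conv_rhs => rw [lintegral_lintegral_swap (by fun_prop)]
    refine lintegral_congr fun z => ?_
    rw [← lintegral_add_right_eq_self (fun θ => h θ * F (θ - c * z, θ)) (c * z)]
    simp
  have hmarg : coordModel c ∘ₘ volume.withDensity h = volume.withDensity (evidence h c) := by
    rw [← Measure.snd_compProd, ← Measure.fst_map_swap, ← key, Measure.fst_compProd]
  rw [hmarg, key]

end Coordinate

/-! ### Asymptotics of the posterior of one coefficient -/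

lemma lintegral_comp_mul_left {a : ℝ} (ha : 0 < a) {F : ℝ → ℝ≥0∞} (hF : Measurable F) :
    ∫⁻ x, F (a * x) = ENNReal.ofReal a⁻¹ * ∫⁻ x, F x := by
  rw [← lintegral_map (f := F) (g := fun x => a * x) hF (by fun_prop),
    Real.map_volume_mul_left ha.ne', lintegral_smul_measure, abs_of_pos (inv_pos.2 ha), smul_eq_mul]

/-- The factor `e^{g²/2}` turns the standard Gaussian into a multiple of Lebesgue measure. -/
lemma lintegral_exp_sq_mul_gaussianReal {F : ℝ → ℝ≥0∞} (hF : Measurable F) :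
    ∫⁻ g, ENNReal.ofReal (Real.exp (g ^ 2 / 2)) * F g ∂gaussianReal 0 1 =
      ENNReal.ofReal (√(2 * Real.pi))⁻¹ * ∫⁻ g, F g := by
  rw [gaussianReal_of_var_ne_zero _ one_ne_zero, lintegral_withDensity_eq_lintegral_mul _
    (measurable_gaussianPDF 0 1) (by fun_prop), ← lintegral_const_mul _ hF]
  refine lintegral_congr fun g => ?_
  rw [Pi.mul_apply, ← mul_assoc, gaussianPDF, ← ENNReal.ofReal_mul (gaussianPDFReal_nonneg _ _ _)]
  congr 2
  simp only [gaussianPDFReal]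
  rw [mul_assoc, ← Real.exp_add]
  norm_num
  ring_nf
  simp

lemma lintegral_exp_sq_div_four_gaussianReal_ne_top :
    ∫⁻ z, ENNReal.ofReal (Real.exp (z ^ 2 / 4)) ∂gaussianReal 0 1 ≠ ∞ := by
  have h1 : ∀ z : ℝ, ENNReal.ofReal (Real.exp (z ^ 2 / 4)) =
      ENNReal.ofReal (Real.exp (z ^ 2 / 2)) * ENNReal.ofReal (Real.exp (-(1 / 4) * z ^ 2)) := by
    intro z
    rw [← ENNReal.ofReal_mul (Real.exp_pos _).le, ← Real.exp_add]
    congr 2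
    ring
  simp_rw [h1]
  rw [lintegral_exp_sq_mul_gaussianReal (by fun_prop)]
  refine ENNReal.mul_ne_top ENNReal.ofReal_ne_top ?_
  have h2 := (integrable_exp_neg_mul_sq (b := 1 / 4) (by norm_num)).lintegral_lt_top
  exact h2.ne

lemma lintegral_exp_neg_mul_abs_ne_top {a : ℝ} (ha : 0 < a) :
    ∫⁻ g : ℝ, ENNReal.ofReal (Real.exp (-(a * |g|))) ≠ ∞ := by
  have h : ∀ g : ℝ, Real.exp (-(a * |g|)) ≤ (1 + 2 / a ^ 2) * (1 + g ^ 2)⁻¹ := by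
    intro g
    have h1 := Real.quadratic_le_exp_of_nonneg (x := a * |g|) (by positivity)
    have h2 : 1 + g ^ 2 ≤ (1 + 2 / a ^ 2) * Real.exp (a * |g|) := by
      have h3 : (a * |g|) ^ 2 = a ^ 2 * g ^ 2 := by rw [mul_pow, sq_abs]
      have h4 : 2 / a ^ 2 * (a ^ 2 * g ^ 2 / 2) = g ^ 2 := by field_simp
      have h5 : 0 ≤ a * |g| := by positivity
      have h6 : 1 + a ^ 2 * g ^ 2 / 2 ≤ Real.exp (a * |g|) := by linarith
      have h7 : 2 / a ^ 2 * (1 + a ^ 2 * g ^ 2 / 2) ≤ 2 / a ^ 2 * Real.exp (a * |g|) :=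
        mul_le_mul_of_nonneg_left h6 (by positivity)
      have h8 : (0 : ℝ) < 2 / a ^ 2 := by positivity
      have h9 : 1 ≤ Real.exp (a * |g|) := Real.one_le_exp h5
      linarith [mul_add (2 / a ^ 2) 1 (a ^ 2 * g ^ 2 / 2)]
    rw [Real.exp_neg, ← div_eq_mul_inv, le_div_iff₀ (by positivity),
      inv_mul_le_iff₀ (Real.exp_pos _)]
    linarith
  refine ne_top_of_le_ne_top ?_ (lintegral_mono fun g => ENNReal.ofReal_le_ofReal (h g))
  exact (integrable_inv_one_add_sq.const_mul (1 + 2 / a ^ 2)).lintegral_lt_top.ne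

namespace SubGaussianDensity

variable (φ : SubGaussianDensity)

/-- The density as an extended nonnegative function. -/
def dens (x : ℝ) : ℝ≥0∞ := ENNReal.ofReal (φ x)

lemma measurable_dens : Measurable φ.dens := φ.measurable.ennreal_ofReal

lemma law_eq : φ.law = volume.withDensity φ.dens := rfl

lemma exists_bound : ∃ B > 0, ∀ x, φ x ≤ B := by
  obtain ⟨a, ha, C, hC, h⟩ := φ.subGaussian
  refine ⟨C, hC, fun x => (h x).trans ?_⟩
  refine mul_le_of_le_one_right hC.le (Real.exp_le_one_iff.2 ?_)
  have := sq_nonneg x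
  nlinarith

lemma lintegral_sq_ne_top : ∫⁻ y, ENNReal.ofReal (y ^ 2) ∂φ.law ≠ ∞ := by
  obtain ⟨a, ha, C, hC, h⟩ := φ.subGaussian
  have h1 : ∫⁻ y, ENNReal.ofReal (y ^ 2) ∂φ.law =
      ∫⁻ y, ENNReal.ofReal (φ y) * ENNReal.ofReal (y ^ 2) := by
    rw [law_eq, lintegral_withDensity_eq_lintegral_mul _ φ.measurable_dens (by fun_prop)]
    rfl
  have h2 : ∀ y : ℝ, φ y * y ^ 2 ≤ C * (2 / a) * Real.exp (-(a / 2) * y ^ 2) := by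
    intro y
    have h3 : y ^ 2 ≤ 2 / a * Real.exp (a / 2 * y ^ 2) := by
      have h4 := Real.add_one_le_exp (a / 2 * y ^ 2)
      have h5 : 2 / a * (a / 2 * y ^ 2) = y ^ 2 := by field_simp
      have h6 : (0 : ℝ) < 2 / a := by positivity
      nlinarith
    calc φ y * y ^ 2 ≤ C * Real.exp (-a * y ^ 2) * (2 / a * Real.exp (a / 2 * y ^ 2)) :=
          mul_le_mul (h y) h3 (sq_nonneg y) (by positivity)
      _ = C * (2 / a) * (Real.exp (-a * y ^ 2) * Real.exp (a / 2 * y ^ 2)) := by ring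
      _ = _ := by rw [← Real.exp_add]; congr 2; ring
  rw [h1]
  refine ne_top_of_le_ne_top ?_ (lintegral_mono fun y =>
    (ENNReal.ofReal_mul (φ.nonneg y)).symm.le.trans (ENNReal.ofReal_le_ofReal (h2 y)))
  exact ((integrable_exp_neg_mul_sq (b := a / 2) (by positivity)).const_mul _).lintegral_lt_top.ne

/-- The density of `r y` when `y` has density `φ`. -/
def scaled (r θ : ℝ) : ℝ≥0∞ := φ.dens (θ / r) / ENNReal.ofReal r

lemma measurable_scaled (r : ℝ) : Measurable (φ.scaled r) :=
  (φ.measurable_dens.comp (measurable_id.div_const r)).div_const _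

lemma law_map_mul {r : ℝ} (hr : 0 < r) :
    φ.law.map (fun y => r * y) = volume.withDensity (φ.scaled r) := by
  refine Measure.ext_of_lintegral _ fun F hF => ?_
  have hm := φ.measurable_dens
  rw [lintegral_map hF (by fun_prop), law_eq,
    lintegral_withDensity_eq_lintegral_mul _ φ.measurable_dens (by fun_prop),
    lintegral_withDensity_eq_lintegral_mul _ (φ.measurable_scaled r) hF]
  have h1 := lintegral_comp_mul_left hr (F := φ.scaled r * F) ((φ.measurable_scaled r).mul hF)
  have h2 : ∫⁻ x, (φ.scaled r * F) x =
      ENNReal.ofReal r * (ENNReal.ofReal r⁻¹ * ∫⁻ x, (φ.scaled r * F) x) := by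
    rw [← mul_assoc, ← ENNReal.ofReal_mul hr.le, mul_inv_cancel₀ hr.ne', ENNReal.ofReal_one,
      one_mul]
  rw [h2, ← h1, ← lintegral_const_mul]
  · refine lintegral_congr fun y => ?_
    have h3 : ENNReal.ofReal r ≠ 0 := (ENNReal.ofReal_pos.2 hr).ne'
    simp only [Pi.mul_apply, scaled]
    rw [mul_div_cancel_left₀ y hr.ne', ← mul_assoc,
      ENNReal.mul_div_cancel h3 ENNReal.ofReal_ne_top]
  · exact ((φ.measurable_scaled r).mul hF).comp (measurable_const_mul r)

/-- The normalising constant of the posterior of a rescaled coefficient: `m` is the true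
coefficient in units of the prior scale, `s` the prior scale in units of the noise level, and `g`
the noise. -/
def norming (s m g : ℝ) : ℝ≥0∞ := ∫⁻ z, φ.dens (m + (g + z) / s) ∂gaussianReal 0 1

/-- The posterior density, with respect to `N(0, 1)`, of a rescaled coefficient. -/
def stdDensity (s m g z : ℝ) : ℝ≥0∞ := φ.dens (m + (g + z) / s) / φ.norming s m g

lemma measurable_norming (s m : ℝ) : Measurable (φ.norming s m) := by
  have := φ.measurable_dens
  unfold norming
  exact Measurable.lintegral_prod_right'
    (f := fun p : ℝ × ℝ => φ.dens (m + (p.1 + p.2) / s)) (by fun_prop)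

lemma measurable_stdDensity (s m : ℝ) : Measurable (Function.uncurry (φ.stdDensity s m)) := by
  have := φ.measurable_dens
  have := φ.measurable_norming s m
  unfold stdDensity Function.uncurry
  fun_prop

lemma arg_eq {r c : ℝ} (hr : r ≠ 0) (θ g z : ℝ) :
    (θ + c * g + c * z) / r = θ / r + (g + z) / (r / c) := by
  field_simp
  ring

lemma evidence_scaled {r c : ℝ} (hr : r ≠ 0) (θ g : ℝ) :
    evidence (φ.scaled r) c (θ + c * g) = φ.norming (r / c) (θ / r) g / ENNReal.ofReal r := by
  have := φ.measurable_dens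
  simp only [evidence, scaled, norming, div_eq_mul_inv _ (ENNReal.ofReal r)]
  rw [← lintegral_mul_const _ (by fun_prop)]
  simp_rw [arg_eq hr]

lemma localDensity_scaled {r c : ℝ} (hr : 0 < r) (θ g z : ℝ) :
    localDensity (φ.scaled r) c (θ + c * g) z = φ.stdDensity (r / c) (θ / r) g z := by
  rw [localDensity, evidence_scaled φ hr.ne', stdDensity, scaled, arg_eq hr.ne',
    div_eq_mul_inv _ (ENNReal.ofReal r), div_eq_mul_inv _ (ENNReal.ofReal r)]
  exact ENNReal.mul_div_mul_right _ _ (ENNReal.inv_ne_zero.2 ENNReal.ofReal_ne_top)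
    (ENNReal.inv_ne_top.2 (ENNReal.ofReal_pos.2 hr).ne')

lemma norming_le {B : ℝ} (hB : ∀ x, φ x ≤ B) (s m g : ℝ) :
    φ.norming s m g ≤ ENNReal.ofReal B := by
  calc φ.norming s m g ≤ ∫⁻ _, ENNReal.ofReal B ∂gaussianReal 0 1 :=
        lintegral_mono fun z => ENNReal.ofReal_le_ofReal (hB _)
    _ = _ := by simp

lemma norming_ne_top (s m g : ℝ) : φ.norming s m g ≠ ∞ := by
  obtain ⟨B, -, hB⟩ := φ.exists_bound
  exact ne_top_of_le_ne_top ENNReal.ofReal_ne_top (φ.norming_le hB s m g)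

/-- Lower bound on the normalising constant when `φ ≥ b` on `(m - δ, m + δ)`. The gain
`e^{|g| d / 2}` over the Gaussian factor comes from the part of the interval `(-d, d)` that lies
in the direction of `g`. -/
lemma le_norming {b m δ : ℝ} (hb : 0 < b) (hδ : 0 < δ)
    (hφ : ∀ x ∈ Set.Ioo (m - δ) (m + δ), b ≤ φ x) {s : ℝ} (hs : 0 < s) {d : ℝ} (hd : 0 < d)
    (hdδ : d ≤ δ) (hds : d ≤ δ * s) (g : ℝ) :
    ENNReal.ofReal (b * (√(2 * Real.pi))⁻¹ * Real.exp (-δ ^ 2 / 2) / 2 * d *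
      Real.exp (-(g ^ 2 / 2) + |g| * d / 2)) ≤ φ.norming s m g := by
  -- half of the interval `|g + z| < d`, on the side where `z ^ 2` is smaller
  obtain ⟨u, hT⟩ : ∃ u : ℝ, ∀ z ∈ Set.Ioo u (u + d / 2),
      |g + z| < d ∧ z ^ 2 ≤ g ^ 2 - |g| * d + δ ^ 2 := by
    rcases le_total 0 g with hg | hg
    · refine ⟨-g + d / 2, fun z hz => ?_⟩
      have h1 := hz.1
      have h2 : g + z < d := by linarith [hz.2]
      rw [abs_of_nonneg hg, abs_lt]
      refine ⟨⟨by linarith, h2⟩, ?_⟩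
      obtain ⟨t, rfl⟩ : ∃ t, z = -g + t := ⟨g + z, by ring⟩
      nlinarith
    · refine ⟨-g - d, fun z hz => ?_⟩
      have h1 : -d < g + z := by linarith [hz.1]
      have h2 := hz.2
      rw [abs_of_nonpos hg, abs_lt]
      refine ⟨⟨h1, by linarith⟩, ?_⟩
      obtain ⟨t, rfl⟩ : ∃ t, z = -g - t := ⟨-g - z, by ring⟩
      nlinarith
  set T := Set.Ioo u (u + d / 2) with hTdef
  set p : ℝ := (√(2 * Real.pi))⁻¹ * Real.exp (-((g ^ 2 - |g| * d + δ ^ 2) / 2)) with hp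
  have hpT : ENNReal.ofReal (p * (d / 2)) ≤ gaussianReal 0 1 T := by
    rw [gaussianReal_apply _ one_ne_zero]
    calc ENNReal.ofReal (p * (d / 2)) = ∫⁻ _ in T, ENNReal.ofReal p := by
          rw [setLIntegral_const, hTdef, Real.volume_Ioo, ENNReal.ofReal_mul (by positivity)]
          congr 2
          ring
      _ ≤ _ := by
          refine setLIntegral_mono (measurable_gaussianPDF 0 1) fun z hz => ?_
          refine ENNReal.ofReal_le_ofReal ?_
          rw [gaussianPDFReal, hp]
          simp only [NNReal.coe_one, mul_one, sub_zero]
          refine mul_le_mul_of_nonneg_left (Real.exp_le_exp.2 ?_) (by positivity)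
          have := (hT z hz).2
          linarith
  calc _ = ENNReal.ofReal b * ENNReal.ofReal (p * (d / 2)) := by
        rw [← ENNReal.ofReal_mul hb.le, hp]
        congr 1
        have h3 : Real.exp (-((g ^ 2 - |g| * d + δ ^ 2) / 2)) =
            Real.exp (-δ ^ 2 / 2) * Real.exp (-(g ^ 2 / 2) + |g| * d / 2) := by
          rw [← Real.exp_add]
          congr 1
          ring
        rw [h3]
        ring
    _ ≤ ENNReal.ofReal b * gaussianReal 0 1 T := by gcongr
    _ = ∫⁻ _ in T, ENNReal.ofReal b ∂gaussianReal 0 1 := by rw [setLIntegral_const]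
    _ ≤ ∫⁻ z in T, φ.dens (m + (g + z) / s) ∂gaussianReal 0 1 := by
        have := φ.measurable_dens
        refine setLIntegral_mono (by fun_prop) fun z hz => ENNReal.ofReal_le_ofReal (hφ _ ?_)
        have h4 : |(g + z) / s| < δ := by
          rw [abs_div, abs_of_pos hs, div_lt_iff₀ hs]
          exact (hT z hz).1.trans_le hds
        rw [abs_lt] at h4
        exact ⟨by linarith, by linarith⟩
    _ ≤ _ := setLIntegral_le_lintegral _ _

lemma norming_ne_zero {b m δ : ℝ} (hb : 0 < b) (hδ : 0 < δ)
    (hφ : ∀ x ∈ Set.Ioo (m - δ) (m + δ), b ≤ φ x) {s : ℝ} (hs : 0 < s) (g : ℝ) :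
    φ.norming s m g ≠ 0 := by
  have h := φ.le_norming hb hδ hφ hs (d := min δ (δ * s)) (lt_min hδ (by positivity))
    (min_le_left _ _) (min_le_right _ _) g
  have hd : 0 < min δ (δ * s) := lt_min hδ (by positivity)
  exact ((ENNReal.ofReal_pos.2 (by positivity)).trans_le h).ne'

lemma lintegral_stdDensity {s m g : ℝ} (h0 : φ.norming s m g ≠ 0) :
    ∫⁻ z, φ.stdDensity s m g z ∂gaussianReal 0 1 = 1 := by
  have := φ.measurable_dens
  simp_rw [stdDensity, div_eq_mul_inv]
  rw [lintegral_mul_const _ (by fun_prop)]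
  exact ENNReal.mul_inv_cancel h0 (φ.norming_ne_top s m g)

lemma lintegral_dens_affine {s : ℝ} (hs : 0 < s) (m z : ℝ) :
    ∫⁻ g, φ.dens (m + (g + z) / s) = ENNReal.ofReal s := by
  have h1 := lintegral_comp_mul_left (inv_pos.2 hs)
    (F := fun x => φ.dens (m + x)) (φ.measurable_dens.comp (measurable_const_add m))
  rw [inv_inv] at h1
  have h2 := lintegral_add_right_eq_self (μ := volume) (fun g => φ.dens (m + s⁻¹ * g)) z
  have h3 := lintegral_add_left_eq_self (μ := volume) φ.dens m
  have h4 : ∫⁻ x, φ.dens x = 1 := φ.lintegral_eq_one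
  rw [h3, h4, mul_one] at h1
  rw [← h1, ← h2]
  refine lintegral_congr fun g => ?_
  rw [inv_mul_eq_div]

/-- Exponential moment bound: the rescaled posterior of a coefficient has, on average
over the noise, bounded Gaussian exponential moments, uniformly in the ratio `s` between prior
scale and noise level. For `s ≥ 1` the density `φ` is bounded and the factor `e^{-|g| δ / 2}` from
`le_norming` is integrable; for `s < 1` the total mass of `φ` is used. -/
theorem exists_lintegral_exp_sq_le {b M τ : ℝ} (hb : 0 < b) (hM : M < τ)
    (hφ : ∀ x ∈ Set.Ioo (-τ) τ, b ≤ φ x) :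
    ∃ K : ℝ≥0∞, K ≠ ∞ ∧ ∀ s > 0, ∀ m, |m| ≤ M →
      ∫⁻ g, ∫⁻ z, ENNReal.ofReal (Real.exp (z ^ 2 / 4)) * φ.stdDensity s m g z
        ∂gaussianReal 0 1 ∂gaussianReal 0 1 ≤ K := by
  obtain ⟨B, hB0, hB⟩ := φ.exists_bound
  have hmd := φ.measurable_dens
  set δ := τ - M with hδdef
  have hδ : 0 < δ := sub_pos.2 hM
  set κ := b * (√(2 * Real.pi))⁻¹ * Real.exp (-δ ^ 2 / 2) / 2 with hκdef
  have hκ : 0 < κ := by positivity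
  set G := ∫⁻ z, ENNReal.ofReal (Real.exp (z ^ 2 / 4)) ∂gaussianReal 0 1 with hG
  have hGtop : G ≠ ∞ := lintegral_exp_sq_div_four_gaussianReal_ne_top
  set H := ∫⁻ g : ℝ, ENNReal.ofReal (Real.exp (-(δ / 2 * |g|))) with hH
  have hHtop : H ≠ ∞ := lintegral_exp_neg_mul_abs_ne_top (by positivity)
  set P := ENNReal.ofReal (√(2 * Real.pi))⁻¹ with hP
  set A := ENNReal.ofReal (κ * δ)⁻¹ with hA
  refine ⟨A * ENNReal.ofReal B * G * (P * H) + A * (P * G), ?_, fun s hs m hm => ?_⟩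
  · have h1 : A ≠ ∞ := ENNReal.ofReal_ne_top
    have h2 : P ≠ ∞ := ENNReal.ofReal_ne_top
    finiteness
  have hφm : ∀ x ∈ Set.Ioo (m - δ) (m + δ), b ≤ φ x := fun x hx => by
    have := abs_le.1 hm
    exact hφ x ⟨by linarith [hx.1], by linarith [hx.2]⟩
  have hsplit : ∀ g, ∫⁻ z, ENNReal.ofReal (Real.exp (z ^ 2 / 4)) * φ.stdDensity s m g z
      ∂gaussianReal 0 1 = (∫⁻ z, ENNReal.ofReal (Real.exp (z ^ 2 / 4)) *
        φ.dens (m + (g + z) / s) ∂gaussianReal 0 1) * (φ.norming s m g)⁻¹ := by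
    intro g
    rw [← lintegral_mul_const _ (by fun_prop)]
    simp_rw [stdDensity, div_eq_mul_inv, mul_assoc]
  simp_rw [hsplit]
  rcases le_total 1 s with h1s | h1s
  -- flat prior: bounded density in the numerator, `d = δ` in `le_norming`
  · refine le_trans ?_ le_self_add
    have hnum : ∀ g, ∫⁻ z, ENNReal.ofReal (Real.exp (z ^ 2 / 4)) *
        φ.dens (m + (g + z) / s) ∂gaussianReal 0 1 ≤ ENNReal.ofReal B * G := by
      intro g
      rw [hG, ← lintegral_const_mul _ (by fun_prop)]
      refine lintegral_mono fun z => ?_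
      rw [mul_comm]
      gcongr
      exact ENNReal.ofReal_le_ofReal (hB _)
    have hden : ∀ g, (φ.norming s m g)⁻¹ ≤ A * (ENNReal.ofReal (Real.exp (g ^ 2 / 2)) *
        ENNReal.ofReal (Real.exp (-(δ / 2 * |g|)))) := by
      intro g
      have h := φ.le_norming hb hδ hφm hs hδ le_rfl (le_mul_of_one_le_right hδ.le h1s) g
      rw [← hκdef] at h
      refine (ENNReal.inv_le_inv.2 h).trans ?_
      rw [← ENNReal.ofReal_inv_of_pos (by positivity), hA, ← ENNReal.ofReal_mul (Real.exp_pos _).le,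
        ← ENNReal.ofReal_mul (by positivity), ← Real.exp_add, mul_inv, ← Real.exp_neg]
      refine ENNReal.ofReal_le_ofReal (le_of_eq ?_)
      congr 2
      ring
    calc _ ≤ ∫⁻ g, (ENNReal.ofReal B * G * A) * (ENNReal.ofReal (Real.exp (g ^ 2 / 2)) *
          ENNReal.ofReal (Real.exp (-(δ / 2 * |g|)))) ∂gaussianReal 0 1 := by
          refine lintegral_mono fun g => ?_
          rw [mul_assoc]
          exact mul_le_mul' (hnum g) (hden g)
      _ = _ := by
          rw [lintegral_const_mul _ (by fun_prop), lintegral_exp_sq_mul_gaussianReal (by fun_prop)]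
          ring
  -- peaked prior: `d = δ s` in `le_norming`, whose factor `s⁻¹` is cancelled by
  -- the Lebesgue integral over `g` of `φ (m + (g + z) / s)`
  · refine le_trans ?_ le_add_self
    have hden : ∀ g, (φ.norming s m g)⁻¹ ≤
        A * (ENNReal.ofReal s)⁻¹ * ENNReal.ofReal (Real.exp (g ^ 2 / 2)) := by
      intro g
      have h := φ.le_norming hb hδ hφm hs (d := δ * s) (by positivity)
        (mul_le_of_le_one_right hδ.le h1s) le_rfl g
      rw [← hκdef] at h
      refine (ENNReal.inv_le_inv.2 h).trans ?_
      rw [← ENNReal.ofReal_inv_of_pos (by positivity), ← ENNReal.ofReal_inv_of_pos hs, hA,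
        ← ENNReal.ofReal_mul (by positivity), ← ENNReal.ofReal_mul (by positivity)]
      refine ENNReal.ofReal_le_ofReal ?_
      have h5 : (κ * (δ * s) * Real.exp (-(g ^ 2 / 2) + |g| * (δ * s) / 2))⁻¹ =
          (κ * δ)⁻¹ * s⁻¹ * Real.exp (g ^ 2 / 2 - |g| * (δ * s) / 2) := by
        rw [mul_inv, ← Real.exp_neg, ← mul_assoc κ, mul_inv]
        congr 2
        ring
      rw [h5]
      refine mul_le_mul_of_nonneg_left (Real.exp_le_exp.2 ?_) (by positivity)
      have : 0 ≤ |g| * (δ * s) / 2 := by positivity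
      linarith
    have hm1 : Measurable fun g => ∫⁻ z, ENNReal.ofReal (Real.exp (z ^ 2 / 4)) *
        φ.dens (m + (g + z) / s) ∂gaussianReal 0 1 :=
      Measurable.lintegral_prod_right' (f := fun q : ℝ × ℝ =>
        ENNReal.ofReal (Real.exp (q.2 ^ 2 / 4)) * φ.dens (m + (q.1 + q.2) / s)) (by fun_prop)
    calc _ ≤ ∫⁻ g, A * (ENNReal.ofReal s)⁻¹ * (ENNReal.ofReal (Real.exp (g ^ 2 / 2)) *
          ∫⁻ z, ENNReal.ofReal (Real.exp (z ^ 2 / 4)) *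
            φ.dens (m + (g + z) / s) ∂gaussianReal 0 1) ∂gaussianReal 0 1 := by
          refine lintegral_mono fun g => ?_
          rw [← mul_assoc, mul_comm]
          exact mul_le_mul' (hden g) le_rfl
      _ = A * (ENNReal.ofReal s)⁻¹ * (P * (G * ENNReal.ofReal s)) := by
          rw [lintegral_const_mul _ (by fun_prop), lintegral_exp_sq_mul_gaussianReal hm1,
            lintegral_lintegral_swap (by fun_prop)]
          congr 2
          rw [hG, ← lintegral_mul_const _ (by fun_prop)]
          refine lintegral_congr fun z => ?_
          rw [lintegral_const_mul _ (by fun_prop), lintegral_dens_affine φ hs]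
      _ = A * (P * G) * ((ENNReal.ofReal s)⁻¹ * ENNReal.ofReal s) := by ring
      _ = A * (P * G) := by
          rw [ENNReal.inv_mul_cancel (ENNReal.ofReal_pos.2 hs).ne' ENNReal.ofReal_ne_top, mul_one]

lemma toReal_stdDensity (s m g z : ℝ) :
    (φ.stdDensity s m g z).toReal = φ (m + (g + z) / s) / (φ.norming s m g).toReal := by
  rw [stdDensity, ENNReal.toReal_div, dens, ENNReal.toReal_ofReal (φ.nonneg _)]

variable {φ}

lemma tendsto_apply_affine {m : ℝ} (hcont : ContinuousAt φ m) {s : ℕ → ℝ}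
    (hs : Tendsto s atTop atTop) (x : ℝ) : Tendsto (fun n => φ (m + x / s n)) atTop (𝓝 (φ m)) := by
  have h : Tendsto (fun n => m + x / s n) atTop (𝓝 (m + 0)) :=
    tendsto_const_nhds.add (hs.const_div_atTop x)
  rw [add_zero] at h
  exact hcont.tendsto.comp h

lemma tendsto_norming {m : ℝ} (hcont : ContinuousAt φ m) {s : ℕ → ℝ}
    (hs : Tendsto s atTop atTop) (g : ℝ) :
    Tendsto (fun n => (φ.norming (s n) m g).toReal) atTop (𝓝 (φ m)) := by
  obtain ⟨B, hB0, hB⟩ := φ.exists_bound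
  have hmd := φ.measurable_dens
  have h1 : Tendsto (fun n => φ.norming (s n) m g) atTop
      (𝓝 (∫⁻ _, φ.dens m ∂gaussianReal 0 1)) := by
    refine tendsto_lintegral_of_dominated_convergence (fun _ => ENNReal.ofReal B)
      (fun n => by fun_prop) (fun n => ae_of_all _ fun z => ENNReal.ofReal_le_ofReal (hB _))
      (by simp) (ae_of_all _ fun z => ?_)
    exact ENNReal.tendsto_ofReal (tendsto_apply_affine hcont hs (g + z))
  have h2 := (ENNReal.tendsto_toReal (by simp [dens])).comp h1
  simpa [dens, φ.nonneg, Function.comp_def] using h2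

/-- As the prior becomes flat at the scale of the noise, the rescaled posterior density converges
to that of `N(0, 1)`. -/
lemma tendsto_stdDensity {m : ℝ} (hcont : ContinuousAt φ m) {s : ℕ → ℝ}
    (hs : Tendsto s atTop atTop) (hm : 0 < φ m) (g z : ℝ) :
    Tendsto (fun n => (φ.stdDensity (s n) m g z).toReal) atTop (𝓝 1) := by
  simp_rw [toReal_stdDensity]
  have := (tendsto_apply_affine hcont hs (g + z)).div (tendsto_norming hcont hs g) hm.ne'
  rwa [div_self hm.ne'] at this

lemma eventually_stdDensity_le {m : ℝ} (hcont : ContinuousAt φ m) {s : ℕ → ℝ}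
    (hs : Tendsto s atTop atTop) (hm : 0 < φ m) (g : ℝ) :
    ∃ D > 0, ∀ᶠ n in atTop, ∀ z, (φ.stdDensity (s n) m g z).toReal ≤ D := by
  obtain ⟨B, hB0, hB⟩ := φ.exists_bound
  refine ⟨B / (φ m / 2), by positivity, ?_⟩
  filter_upwards [(tendsto_norming hcont hs g).eventually (lt_mem_nhds (half_lt_self hm))]
    with n hn z
  rw [toReal_stdDensity]
  exact div_le_div₀ hB0.le (hB _) (by positivity) hn.le

end SubGaussianDensity

/-! ### The space `M₀(w)` as a weighted space of null sequences -/

section Space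

variable {J₀ K₀ : ℕ}

lemma finite_level_lt (L : ℤ) : {i : Index J₀ K₀ | level i < L}.Finite := by
  have h : {i : Index J₀ K₀ | level i < L} ⊆ Set.range Sum.inl ∪
      Sum.inr '' (((Finset.range L.toNat).sigma fun _ => Finset.univ :
        Finset (Σ j : ℕ, Fin (2 ^ (J₀ + j)))) : Set (Σ j : ℕ, Fin (2 ^ (J₀ + j)))) := by
    rintro (i | ⟨j, k⟩) hi
    · exact Or.inl ⟨i, rfl⟩
    · refine Or.inr ⟨⟨j, k⟩, ?_, rfl⟩
      simp only [Set.mem_ofPred_eq, level] at hi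
      simp
      omega
  exact ((Set.finite_range _).union ((Finset.finite_toSet _).image _)).subset h

lemma tendsto_level_cofinite : Tendsto (level : Index J₀ K₀ → ℤ) cofinite atTop := by
  refine tendsto_atTop.2 fun L => ?_
  rw [Filter.Eventually, mem_cofinite]
  refine (finite_level_lt L).subset fun i hi => ?_
  simpa using hi

lemma cofinite_eq_comap_level : (cofinite : Filter (Index J₀ K₀)) = comap level atTop := by
  refine le_antisymm tendsto_level_cofinite.le_comap ?_
  refine le_cofinite_iff_compl_singleton_mem.2 fun i => ?_
  refine mem_comap.2 ⟨Set.Ioi (level i), Ioi_mem_atTop _, fun j hj hji => ?_⟩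
  rw [Set.mem_singleton_iff.1 hji] at hj
  exact lt_irrefl (level i) hj

variable {w : Weight J₀}

lemma mem_M0Submodule_iff {x : Index J₀ K₀ → ℝ} : x ∈ M0Submodule K₀ w ↔
    Tendsto (fun i => |x i| / w (level i)) cofinite (𝓝 0) := by
  have hnn : ∀ i, 0 ≤ |x i| / w (level i) := fun i => div_nonneg (abs_nonneg _) (w.pos i).le
  constructor
  · rintro ⟨-, h⟩
    refine Metric.tendsto_nhds.2 fun ε hε => ?_
    obtain ⟨L, hL⟩ := h (ε / 2) (half_pos hε)
    filter_upwards [tendsto_level_cofinite.eventually_ge_atTop L] with i hi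
    rw [Real.dist_eq, sub_zero, abs_of_nonneg (hnn i)]
    linarith [hL i hi]
  · intro h
    refine ⟨?_, fun ε hε => ?_⟩
    · have h1 : {i | ¬ |x i| / w (level i) < 1}.Finite :=
        h.eventually (gt_mem_nhds one_pos)
      refine ((h1.image fun i => |x i| / w (level i)).bddAbove.union
        (bddAbove_Iio (a := (1 : ℝ)))).mono ?_
      rintro _ ⟨i, rfl⟩
      by_cases hi : |x i| / w (level i) < 1
      · exact Or.inr hi
      · exact Or.inl ⟨i, hi, rfl⟩
    · have h1 : {i | ¬ |x i| / w (level i) < ε}.Finite := h.eventually (gt_mem_nhds hε)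
      obtain ⟨L, hL⟩ := (h1.image level).bddAbove
      refine ⟨L + 1, fun i hi => ?_⟩
      by_contra hcon
      have := hL ⟨i, fun hlt => hcon hlt.le, rfl⟩
      omega

lemma mem_M0Submodule_of_summable_sq {x : Index J₀ K₀ → ℝ} (hx : Summable fun i => x i ^ 2) :
    x ∈ M0Submodule K₀ w := by
  rw [mem_M0Submodule_iff]
  have h1 : Tendsto (fun i => |x i|) cofinite (𝓝 0) := by
    have := (Real.continuous_sqrt.tendsto 0).comp hx.tendsto_cofinite_zero
    simpa [Function.comp_def, Real.sqrt_sq_eq_abs] using this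
  refine squeeze_zero (fun i => div_nonneg (abs_nonneg _) (w.pos i).le) (fun i => ?_) h1
  exact div_le_self (abs_nonneg _) (w.one_le _ (le_level i))

lemma toM0_of_mem {x : Index J₀ K₀ → ℝ} (hx : x ∈ M0Submodule K₀ w) :
    toM0 w x = ⟨x, hx⟩ := dif_pos hx

lemma coeff_toM0 {x : Index J₀ K₀ → ℝ} (hx : x ∈ M0Submodule K₀ w) :
    (toM0 w x).coeff = x := by
  rw [toM0_of_mem hx]; rfl

lemma M0.coeff_mem (x : M0 K₀ w) : x.coeff ∈ M0Submodule K₀ w := x.2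

lemma M0.toM0_coeff (x : M0 K₀ w) : toM0 w x.coeff = x := toM0_of_mem x.2

lemma M0.coeff_sub (x y : M0 K₀ w) (i : Index J₀ K₀) :
    (x - y).coeff i = x.coeff i - y.coeff i := rfl

lemma M0.coeff_smul (a : ℝ) (x : M0 K₀ w) (i : Index J₀ K₀) :
    (a • x).coeff i = a * x.coeff i := rfl

lemma M0.abs_coeff_le (x : M0 K₀ w) (i : Index J₀ K₀) : |x.coeff i| ≤ w (level i) * ‖x‖ := by
  rw [mul_comm, ← div_le_iff₀ (w.pos i)]
  exact le_ciSup x.bddAbove i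

lemma M0.norm_le {x : M0 K₀ w} {C : ℝ} (hC : 0 ≤ C) (h : ∀ i, |x.coeff i| ≤ C * w (level i)) :
    ‖x‖ ≤ C := by
  rw [M0.norm_def]
  exact Real.iSup_le (fun i => (div_le_iff₀ (w.pos i)).2 (h i)) hC

variable (w) in
/-- The coefficient functional `x ↦ x_{lk}` on `M₀(w)`. -/
def coeffCLM (i : Index J₀ K₀) : M0 K₀ w →L[ℝ] ℝ :=
  LinearMap.mkContinuous
    { toFun := fun x => x.coeff i
      map_add' := fun _ _ => rfl
      map_smul' := fun _ _ => rfl } (w (level i)) fun x => x.abs_coeff_le i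

lemma coeffCLM_apply (i : Index J₀ K₀) (x : M0 K₀ w) : coeffCLM w i x = x.coeff i := rfl

open Classical in
/-- The unit sequence at an index, as an element of `M₀(w)`. -/
def unitM0 (w : Weight J₀) (i : Index J₀ K₀) : M0 K₀ w := toM0 w (Pi.single i 1)

open Classical in
lemma coeff_unitM0 (i : Index J₀ K₀) : (unitM0 w i).coeff = Pi.single i 1 := by
  refine coeff_toM0 (mem_M0Submodule_of_summable_sq ?_)
  refine summable_of_ne_finset_zero (s := {i}) fun j hj => ?_
  rw [Pi.single_eq_of_ne (by simpa using hj)]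
  norm_num

/-- The truncation of a sequence to a finite set of indices, as an element of `M₀(w)`. -/
def truncM0 (w : Weight J₀) (s : Finset (Index J₀ K₀)) (x : Index J₀ K₀ → ℝ) : M0 K₀ w :=
  ∑ i ∈ s, x i • unitM0 w i

open Classical in
lemma coeff_truncM0 (s : Finset (Index J₀ K₀)) (x : Index J₀ K₀ → ℝ) (i : Index J₀ K₀) :
    (truncM0 w s x).coeff i = if i ∈ s then x i else 0 := by
  rw [← coeffCLM_apply, truncM0, map_sum]
  simp_rw [map_smul, coeffCLM_apply, coeff_unitM0, Pi.single_apply, smul_eq_mul, mul_ite, mul_one,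
    mul_zero]
  rw [Finset.sum_ite_eq]

lemma continuous_truncM0 (s : Finset (Index J₀ K₀)) : Continuous (truncM0 w s) :=
  continuous_finsetSum _ fun i _ => (continuous_apply i).smul continuous_const

lemma norm_toM0_sub_truncM0_le {x : Index J₀ K₀ → ℝ} (hx : x ∈ M0Submodule K₀ w)
    {s : Finset (Index J₀ K₀)} {δ : ℝ} (hδ : 0 ≤ δ) (h : ∀ i ∉ s, |x i| ≤ δ * w (level i)) :
    ‖toM0 w x - truncM0 w s x‖ ≤ δ := by
  classical
  refine M0.norm_le hδ fun i => ?_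
  rw [M0.coeff_sub, coeff_toM0 hx, coeff_truncM0]
  split_ifs with hi
  · rw [sub_self, abs_zero]
    exact mul_nonneg hδ (w.pos i).le
  · rw [sub_zero]
    exact h i hi

lemma tendsto_truncM0 {x : Index J₀ K₀ → ℝ} (hx : x ∈ M0Submodule K₀ w) :
    Tendsto (fun s => truncM0 w s x) atTop (𝓝 (toM0 w x)) := by
  refine Metric.tendsto_nhds.2 fun ε hε => ?_
  have h1 : {i | ¬ |x i| / w (level i) < ε / 2}.Finite :=
    (mem_M0Submodule_iff.1 hx).eventually (gt_mem_nhds (half_pos hε))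
  filter_upwards [eventually_ge_atTop h1.toFinset] with s hs
  rw [dist_comm, dist_eq_norm]
  refine (norm_toM0_sub_truncM0_le hx (half_pos hε).le fun i hi => ?_).trans_lt (half_lt_self hε)
  rw [← div_le_iff₀ (w.pos i)]
  by_contra hcon
  exact hi (hs (h1.mem_toFinset.2 fun h => hcon h.le))

lemma measurableSet_M0Submodule :
    MeasurableSet {x : Index J₀ K₀ → ℝ | x ∈ M0Submodule K₀ w} := by
  simp_rw [mem_M0Submodule_iff, cofinite_eq_comap_level]
  exact measurableSet_tendsto _ fun i => by fun_prop

lemma stronglyMeasurable_toM0 : StronglyMeasurable (toM0 w : (Index J₀ K₀ → ℝ) → M0 K₀ w) := by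
  classical
  -- a pointwise limit of truncations, on the measurable set `M₀(w)`
  refine stronglyMeasurable_of_tendsto (atTop : Filter (Finset (Index J₀ K₀)))
    (f := fun s => {x | x ∈ M0Submodule K₀ w}.indicator (truncM0 w s))
    (fun s => (continuous_truncM0 s).stronglyMeasurable.indicator measurableSet_M0Submodule)
    (tendsto_pi_nhds.2 fun x => ?_)
  by_cases hx : x ∈ M0Submodule K₀ w
  · simp only [Set.indicator_of_mem (show x ∈ {x | x ∈ M0Submodule K₀ w} from hx)]
    exact tendsto_truncM0 hx
  · simp only [Set.indicator_of_notMem (show x ∉ {x | x ∈ M0Submodule K₀ w} from hx)]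
    have h0 : toM0 w x = 0 := dif_neg hx
    rw [h0]
    exact tendsto_const_nhds

lemma measurable_toM0 : Measurable (toM0 w : (Index J₀ K₀ → ℝ) → M0 K₀ w) :=
  stronglyMeasurable_toM0.measurable

/-- `M₀(w)` is separable, as the unit sequences span a dense subspace. -/
instance : SecondCountableTopology (M0 K₀ w) := by
  have h : TopologicalSpace.IsSeparable (Set.univ : Set (M0 K₀ w)) := by
    refine ((Set.countable_range (unitM0 w (K₀ := K₀))).isSeparable.span (R := ℝ)).closure.mono
      fun x _ => ?_
    have h1 := tendsto_truncM0 x.coeff_mem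
    rw [x.toM0_coeff] at h1
    refine mem_closure_of_tendsto h1 (Eventually.of_forall fun s => ?_)
    exact Submodule.sum_mem _ fun i _ =>
      Submodule.smul_mem _ _ (Submodule.subset_span ⟨i, rfl⟩)
  have := TopologicalSpace.isSeparable_univ_iff.1 h
  exact UniformSpace.secondCountable_of_separable _

lemma toM0_smul_sub {x y : Index J₀ K₀ → ℝ} (hx : x ∈ M0Submodule K₀ w)
    (hy : y ∈ M0Submodule K₀ w) (a : ℝ) :
    toM0 w (a • (x - y)) = a • (toM0 w x - toM0 w y) := by
  rw [toM0_of_mem hx, toM0_of_mem hy, toM0_of_mem (Submodule.smul_mem _ a (Submodule.sub_mem _ hx hy))]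
  rfl

end Space

/-! ### Admissible weights -/

section Weights

variable {J₀ K₀ : ℕ}

lemma summable_index {F : ℤ → ℝ} (hF : ∀ l, 0 ≤ F l)
    (h : Summable fun j : ℕ => (2 : ℝ) ^ (J₀ + j) * F (J₀ + j)) :
    Summable fun i : Index J₀ K₀ => F (level i) := by
  have h1 : Summable fun i : Σ j : ℕ, Fin (2 ^ (J₀ + j)) => F (J₀ + (i.1 : ℤ)) := by
    refine (summable_sigma_of_nonneg fun _ => hF _).2 ⟨fun _ => .of_finite, ?_⟩
    simpa using h
  exact Summable.sum _ (Summable.of_finite) h1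

/-- For admissible weights, the Gaussian tails `e^{-a w_l²}` are summable over all indices. -/
lemma summable_exp_neg_weight_sq {w : Weight J₀} (hw : w.Admissible) {a : ℝ} (ha : 0 < a) :
    Summable fun i : Index J₀ K₀ => Real.exp (-(a * w (level i) ^ 2)) := by
  refine summable_index (F := fun l => Real.exp (-(a * w l ^ 2)))
    (fun l => (Real.exp_pos _).le) ?_
  -- eventually `a w_l² ≥ l`, so that the `2 ^ l` terms at level `l` sum to at most `(2 / e) ^ l`
  have hr : Real.exp (-1) * 2 < 1 := by
    have := Real.exp_one_gt_d9
    rw [Real.exp_neg, inv_mul_lt_iff₀ (Real.exp_pos _)]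
    linarith
  have hgeo : Summable fun j : ℕ => (Real.exp (-1) * 2) ^ (J₀ + j) := by
    simp_rw [pow_add]
    exact (summable_geometric_of_lt_one (by positivity) hr).mul_left _
  refine Summable.of_norm_bounded_eventually_nat hgeo ?_
  have h1 : Tendsto (fun j : ℕ => (J₀ : ℤ) + j) atTop atTop :=
    tendsto_atTop_add_const_left _ _ tendsto_natCast_atTop_atTop
  filter_upwards [h1.eventually (hw.eventually_ge_atTop (√(1 / a))),
    h1.eventually_ge_atTop 1] with j hj hj1
  have hj1' : (1 : ℝ) ≤ (((J₀ : ℤ) + j : ℤ) : ℝ) := by exact_mod_cast hj1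
  set l : ℤ := (J₀ : ℤ) + j with hl
  have hsq : (l : ℝ) ≤ a * w l ^ 2 := by
    have h2 : 0 < √(l : ℝ) := Real.sqrt_pos.2 (by linarith)
    rw [le_div_iff₀ h2, ← Real.sqrt_mul (by positivity)] at hj
    have h3 : 1 / a * l ≤ w l ^ 2 := by
      have h4 := pow_le_pow_left₀ (Real.sqrt_nonneg _) hj 2
      rwa [Real.sq_sqrt (by positivity)] at h4
    calc (l : ℝ) = a * (1 / a * l) := by field_simp
      _ ≤ _ := mul_le_mul_of_nonneg_left h3 ha.le
  have hl' : (l : ℝ) = ((J₀ + j : ℕ) : ℝ) := by rw [hl]; push_cast; ring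
  rw [Real.norm_eq_abs, abs_of_nonneg (by positivity), mul_pow, mul_comm, ← Real.exp_nat_mul]
  refine mul_le_mul_of_nonneg_right (Real.exp_le_exp.2 ?_) (by positivity)
  rw [← hl']
  linarith

lemma tsum_exp_neg_weight_sq_ne_top {w : Weight J₀} (hw : w.Admissible) {a : ℝ} (ha : 0 < a) :
    ∑' i : Index J₀ K₀, ENNReal.ofReal (Real.exp (-(a * w (level i) ^ 2))) ≠ ∞ :=
  (summable_exp_neg_weight_sq hw ha).tsum_ofReal_ne_top

/-- Chebyshev's inequality for `e^{z²/4}`, which bounds Gaussian tails. -/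
lemma measure_lt_abs_le (μ : Measure ℝ) {t : ℝ} (ht : 0 ≤ t) :
    μ {z | t < |z|} ≤ ENNReal.ofReal (Real.exp (-(t ^ 2 / 4))) *
      ∫⁻ z, ENNReal.ofReal (Real.exp (z ^ 2 / 4)) ∂μ := by
  have h0 : MeasurableSet {z : ℝ | t < |z|} := measurableSet_lt (by fun_prop) (by fun_prop)
  rw [← lintegral_const_mul _ (by fun_prop), ← lintegral_indicator_one h0]
  refine lintegral_mono fun z => ?_
  by_cases hz : z ∈ {z : ℝ | t < |z|}
  · rw [Set.indicator_of_mem hz, ← ENNReal.ofReal_mul (Real.exp_pos _).le, ← Real.exp_add,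
      Pi.one_apply, ← ENNReal.ofReal_one]
    refine ENNReal.ofReal_le_ofReal (Real.one_le_exp ?_)
    have h1 : t ^ 2 ≤ |z| ^ 2 := pow_le_pow_left₀ ht (le_of_lt hz) 2
    rw [sq_abs] at h1
    linarith
  · rw [Set.indicator_of_notMem hz]
    exact zero_le

/-- The white noise belongs to `M₀(w)` almost surely, by the Borel-Cantelli lemma. -/
theorem ae_whiteNoise_mem {w : Weight J₀} (hw : w.Admissible) :
    ∀ᵐ g ∂(whiteNoise J₀ K₀), g ∈ M0Submodule K₀ w := by
  have h1 : ∀ m : ℕ, ∀ᵐ g ∂(whiteNoise J₀ K₀), ∀ᶠ i in cofinite,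
      ¬ ((m + 1 : ℝ)⁻¹ * w (level i) < |g i|) := by
    intro m
    refine ae_finite_setOfPred_mem
      (s := fun i : Index J₀ K₀ => {g | (m + 1 : ℝ)⁻¹ * w (level i) < |g i|}) ?_ |>.mono
      fun g hg => ?_
    swap
    · simpa only [Filter.Eventually, mem_cofinite, Set.compl_def, Set.mem_ofPred_eq, not_not]
        using hg
    have ha : (0 : ℝ) < ((m + 1 : ℝ)⁻¹) ^ 2 / 4 := by positivity
    have h2 : ∀ i : Index J₀ K₀, whiteNoise J₀ K₀ {g | (m + 1 : ℝ)⁻¹ * w (level i) < |g i|} ≤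
        ENNReal.ofReal (Real.exp (-(((m + 1 : ℝ)⁻¹) ^ 2 / 4 * w (level i) ^ 2))) *
          ∫⁻ z, ENNReal.ofReal (Real.exp (z ^ 2 / 4)) ∂gaussianReal 0 1 := by
      intro i
      have h3 := measure_lt_abs_le (gaussianReal 0 1) (t := (m + 1 : ℝ)⁻¹ * w (level i))
        (mul_nonneg (by positivity) (w.pos i).le)
      have h4 := Measure.infinitePi_map_eval (fun _ : Index J₀ K₀ => gaussianReal 0 1) i
      rw [← h4, Measure.map_apply (measurable_pi_apply i)
        (measurableSet_lt (by fun_prop) (by fun_prop)), h4] at h3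
      refine h3.trans (le_of_eq ?_)
      congr 4
      ring
    refine ne_top_of_le_ne_top ?_ (ENNReal.tsum_le_tsum h2)
    rw [ENNReal.tsum_mul_right]
    exact ENNReal.mul_ne_top (tsum_exp_neg_weight_sq_ne_top hw ha)
      lintegral_exp_sq_div_four_gaussianReal_ne_top
  filter_upwards [ae_all_iff.2 h1] with g hg
  rw [mem_M0Submodule_iff]
  refine Metric.tendsto_nhds.2 fun ε hε => ?_
  obtain ⟨m, hm⟩ := exists_nat_one_div_lt hε
  filter_upwards [hg m] with i hi
  rw [Real.dist_eq, sub_zero, abs_of_nonneg (div_nonneg (abs_nonneg _) (w.pos i).le)]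
  rw [not_lt, ← div_le_iff₀ (w.pos i)] at hi
  rw [one_div] at hm
  exact hi.trans_lt hm

end Weights

/-! ### Bias and exponential moments of the rescaled posterior of one coefficient -/

namespace SubGaussianDensity

variable (φ : SubGaussianDensity)

/-- The mean of the rescaled posterior of a coefficient. -/
def bias (s m g : ℝ) : ℝ := ∫ z, z * (φ.stdDensity s m g z).toReal ∂gaussianReal 0 1

/-- The moment `E e^{z²/4}` under the rescaled posterior of a coefficient. -/
def expMoment (s m g : ℝ) : ℝ≥0∞ :=
  ∫⁻ z, ENNReal.ofReal (Real.exp (z ^ 2 / 4)) * φ.stdDensity s m g z ∂gaussianReal 0 1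

lemma measurable_bias (s m : ℝ) : Measurable (φ.bias s m) := by
  have h := φ.measurable_stdDensity s m
  have h1 : Measurable (Function.uncurry fun g z : ℝ => z * (φ.stdDensity s m g z).toReal) :=
    measurable_snd.mul h.ennreal_toReal
  exact h1.stronglyMeasurable.integral_prod_right.measurable

lemma measurable_expMoment (s m : ℝ) : Measurable (φ.expMoment s m) := by
  have h := φ.measurable_stdDensity s m
  have h1 : Measurable fun p : ℝ × ℝ =>
      ENNReal.ofReal (Real.exp (p.2 ^ 2 / 4)) * φ.stdDensity s m p.1 p.2 :=
    (by fun_prop : Measurable fun p : ℝ × ℝ => ENNReal.ofReal (Real.exp (p.2 ^ 2 / 4))).mul h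
  exact h1.lintegral_prod_right'

lemma measurable_stdDensity_right (s m g : ℝ) : Measurable (φ.stdDensity s m g) := by
  have := φ.measurable_dens
  unfold stdDensity
  fun_prop

lemma integrable_mul_stdDensity (s m g : ℝ) {f : ℝ → ℝ} (hf : Integrable f (gaussianReal 0 1)) :
    Integrable (fun z => f z * (φ.stdDensity s m g z).toReal) (gaussianReal 0 1) := by
  obtain ⟨B, hB0, hB⟩ := φ.exists_bound
  refine hf.mul_bdd (c := B / (φ.norming s m g).toReal)
    (φ.measurable_stdDensity_right s m g).ennreal_toReal.aestronglyMeasurable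
    (ae_of_all _ fun z => ?_)
  rw [Real.norm_eq_abs, abs_of_nonneg ENNReal.toReal_nonneg, toReal_stdDensity]
  exact div_le_div_of_nonneg_right (hB _) ENNReal.toReal_nonneg

lemma integrable_id_gaussianReal : Integrable (fun z : ℝ => z) (gaussianReal 0 1) :=
  (memLp_id_gaussianReal 1).integrable le_rfl

lemma integral_stdDensity {s m g : ℝ} (h0 : φ.norming s m g ≠ 0) :
    ∫ z, (φ.stdDensity s m g z).toReal ∂gaussianReal 0 1 = 1 := by
  have h1 := φ.lintegral_stdDensity h0
  rw [integral_toReal (φ.measurable_stdDensity_right s m g).aemeasurable, h1, ENNReal.toReal_one]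
  exact ae_lt_top (φ.measurable_stdDensity_right s m g) (by rw [h1]; exact ENNReal.one_ne_top)

/-- Jensen's inequality for `e^{z²/4}`, from its tangent at the bias. -/
lemma exp_bias_sq_le {s m g : ℝ} (h0 : φ.norming s m g ≠ 0) :
    ENNReal.ofReal (Real.exp (φ.bias s m g ^ 2 / 4)) ≤ φ.expMoment s m g := by
  set b := φ.bias s m g with hb
  have hi1 := φ.integrable_mul_stdDensity s m g integrable_id_gaussianReal
  have hi0 := φ.integrable_mul_stdDensity s m g (integrable_const (1 : ℝ))
  simp only [one_mul] at hi0
  set E := Real.exp (b ^ 2 / 4) with hE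
  -- integrate the tangent `E (1 + (z - b) b / 2)` of `e^{z²/4}` at `z = b`
  have h1 : ∫ z, (E * (1 - b ^ 2 / 2) * (φ.stdDensity s m g z).toReal +
      E * (b / 2) * (z * (φ.stdDensity s m g z).toReal)) ∂gaussianReal 0 1 = E := by
    rw [integral_add (hi0.const_mul _) (hi1.const_mul _), integral_const_mul, integral_const_mul,
      φ.integral_stdDensity h0]
    change _ + _ * φ.bias s m g = _
    rw [← hb]
    ring
  have hsum : Integrable (fun z => E * (1 - b ^ 2 / 2) * (φ.stdDensity s m g z).toReal +
      E * (b / 2) * (z * (φ.stdDensity s m g z).toReal)) (gaussianReal 0 1) :=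
    (hi0.const_mul _).add (hi1.const_mul _)
  rw [← h1, integral_eq_lintegral_pos_part_sub_lintegral_neg_part hsum]
  refine (ENNReal.ofReal_le_ofReal (sub_le_self _ ENNReal.toReal_nonneg)).trans
    (ENNReal.ofReal_toReal_le.trans (lintegral_mono_ae ?_))
  have h2 := φ.lintegral_stdDensity h0
  filter_upwards [ae_lt_top (φ.measurable_stdDensity_right s m g)
    (by rw [h2]; exact ENNReal.one_ne_top)] with z hz
  rw [← ENNReal.ofReal_toReal hz.ne, ← ENNReal.ofReal_mul (Real.exp_pos _).le,
    ENNReal.toReal_ofReal ENNReal.toReal_nonneg]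
  refine ENNReal.ofReal_le_ofReal ?_
  have h3 : E * (1 + (z - b) * b / 2) ≤ Real.exp (z ^ 2 / 4) := by
    have h4 : z ^ 2 / 4 = b ^ 2 / 4 + (z ^ 2 / 4 - b ^ 2 / 4) := by ring
    rw [h4, Real.exp_add]
    refine mul_le_mul_of_nonneg_left ?_ (Real.exp_pos _).le
    have h5 := Real.add_one_le_exp (z ^ 2 / 4 - b ^ 2 / 4)
    nlinarith [sq_nonneg (z - b)]
  calc _ = E * (1 + (z - b) * b / 2) * (φ.stdDensity s m g z).toReal := by ring
    _ ≤ _ := mul_le_mul_of_nonneg_right h3 ENNReal.toReal_nonneg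

variable {φ} in
lemma tendsto_bias {m : ℝ} (hcont : ContinuousAt φ m) {s : ℕ → ℝ}
    (hs : Tendsto s atTop atTop) (hm : 0 < φ m) (g : ℝ) :
    Tendsto (fun n => φ.bias (s n) m g) atTop (𝓝 0) := by
  obtain ⟨D, hD0, hD⟩ := eventually_stdDensity_le hcont hs hm g
  have h1 : Tendsto (fun n => φ.bias (s n) m g) atTop
      (𝓝 (∫ z, z * 1 ∂gaussianReal 0 1)) := by
    refine tendsto_integral_filter_of_dominated_convergence (fun z => |z| * D)
      (Eventually.of_forall fun n => (measurable_id.mul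
        (φ.measurable_stdDensity_right (s n) m g).ennreal_toReal).aestronglyMeasurable)
      ?_ (integrable_id_gaussianReal.abs.mul_const D)
      (ae_of_all _ fun z => (tendsto_stdDensity hcont hs hm g z).const_mul z)
    filter_upwards [hD] with n hn
    refine ae_of_all _ fun z => ?_
    rw [norm_mul, Real.norm_eq_abs, Real.norm_eq_abs, abs_of_nonneg ENNReal.toReal_nonneg]
    exact mul_le_mul_of_nonneg_left (hn z) (abs_nonneg z)
  simpa using h1

end SubGaussianDensity

/-! ### Completeness of `M₀(w)` -/

/-- `M₀(w)` is a Banach space; otherwise Bochner integrals in it would be junk. -/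
instance {J₀ K₀ : ℕ} {w : Weight J₀} : CompleteSpace (M0 K₀ w) := by
  refine Metric.complete_of_cauchySeq_tendsto fun u hu => ?_
  have h1 : ∀ i, ∃ y, Tendsto (fun n => (u n).coeff i) atTop (𝓝 y) := fun i =>
    cauchySeq_tendsto_of_complete (hu.map (coeffCLM w i).uniformContinuous)
  choose y hy using h1
  have h2 : ∀ ε > 0, ∃ N, ∀ n ≥ N, ∀ i, |(u n).coeff i - y i| ≤ ε * w (level i) := by
    intro ε hε
    obtain ⟨N, hN⟩ := Metric.cauchySeq_iff.1 hu ε hε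
    refine ⟨N, fun n hn i => ?_⟩
    refine le_of_tendsto ((tendsto_const_nhds.sub (hy i)).abs) ?_
    filter_upwards [eventually_ge_atTop N] with k hk
    have h3 := (u n - u k).abs_coeff_le i
    have h4 := hN n hn k hk
    rw [dist_eq_norm] at h4
    rw [M0.coeff_sub] at h3
    nlinarith [w.pos i]
  have hmem : y ∈ M0Submodule K₀ w := by
    rw [mem_M0Submodule_iff]
    refine Metric.tendsto_nhds.2 fun ε hε => ?_
    obtain ⟨N, hN⟩ := h2 (ε / 2) (half_pos hε)
    have h3 := mem_M0Submodule_iff.1 (u N).coeff_mem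
    filter_upwards [h3.eventually (gt_mem_nhds (half_pos hε))] with i hi
    rw [Real.dist_eq, sub_zero, abs_of_nonneg (div_nonneg (abs_nonneg _) (w.pos i).le),
      div_lt_iff₀ (w.pos i)]
    rw [div_lt_iff₀ (w.pos i)] at hi
    have h4 := hN N le_rfl i
    have h5 : |y i| ≤ |(u N).coeff i| + |(u N).coeff i - y i| := by
      rw [abs_sub_comm]
      calc |y i| = |(u N).coeff i + (y i - (u N).coeff i)| := by congr 1; ring
        _ ≤ _ := abs_add_le _ _
    linarith
  refine ⟨toM0 w y, Metric.tendsto_atTop.2 fun ε hε => ?_⟩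
  obtain ⟨N, hN⟩ := h2 (ε / 2) (half_pos hε)
  refine ⟨N, fun n hn => ?_⟩
  rw [dist_eq_norm]
  refine lt_of_le_of_lt (M0.norm_le (half_pos hε).le fun i => ?_) (half_lt_self hε)
  rw [M0.coeff_sub, coeff_toM0 hmem]
  exact hN n hn i

/-! ### Bounds on the bounded Lipschitz distance -/

section BoundedLipschitz

lemma integrable_of_measurable_of_bound {X : Type*} [MeasurableSpace X] (μ : Measure X)
    [IsFiniteMeasure μ] {F : X → ℝ} (hF : Measurable F) {C : ℝ} (hC : ∀ x, |F x| ≤ C) :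
    Integrable F μ :=
  Integrable.of_bound hF.aestronglyMeasurable C (ae_of_all _ hC)

lemma abs_integral_le_one {X : Type*} [MeasurableSpace X] (μ : Measure X) [IsProbabilityMeasure μ] {F : X → ℝ}
    (hF : ∀ x, |F x| ≤ 1) : |∫ x, F x ∂μ| ≤ 1 := by
  have := norm_integral_le_of_norm_le_const (μ := μ) (f := F) (C := 1) (ae_of_all _ hF)
  simpa using this

variable {S : Type*} [MetricSpace S]

lemma abs_le_one_of_blNorm_le {F : S → ℝ} (hF : blNorm F ≤ 1) (x : S) : |F x| ≤ 1 := by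
  have h : ENNReal.ofReal |F x| ≤ 1 :=
    (le_iSup (fun x => ENNReal.ofReal |F x|) x).trans (le_self_add.trans hF)
  exact ENNReal.ofReal_le_one.1 h

lemma abs_sub_le_dist_of_blNorm_le {F : S → ℝ} (hF : blNorm F ≤ 1) (x y : S) :
    |F x - F y| ≤ dist x y := by
  rcases eq_or_ne x y with rfl | hxy
  · simp
  have h : ENNReal.ofReal (|F x - F y| / dist x y) ≤ 1 := by
    refine le_trans ?_ (le_add_self.trans hF)
    exact le_iSup_of_le x (le_iSup_of_le y (le_iSup_of_le hxy le_rfl))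
  have h1 := ENNReal.ofReal_le_one.1 h
  rwa [div_le_one (dist_pos.2 hxy)] at h1

lemma continuous_of_blNorm_le {F : S → ℝ} (hF : blNorm F ≤ 1) : Continuous F :=
  (LipschitzWith.of_dist_le_mul (K := 1) fun x y => by
    rw [Real.dist_eq, NNReal.coe_one, one_mul]
    exact abs_sub_le_dist_of_blNorm_le hF x y).continuous

variable [MeasurableSpace S]

lemma blDist_le {μ ν : Measure S} {C : ℝ}
    (h : ∀ F : S → ℝ, blNorm F ≤ 1 → |∫ x, F x ∂μ - ∫ x, F x ∂ν| ≤ C) : blDist μ ν ≤ C := by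
  have : Nonempty {F : S → ℝ // blNorm F ≤ 1} := ⟨⟨fun _ => 0, by simp [blNorm]⟩⟩
  exact ciSup_le fun F => h F.1 F.2

lemma le_blDist {μ ν : Measure S} [IsProbabilityMeasure μ] [IsProbabilityMeasure ν] {F : S → ℝ}
    (hF : blNorm F ≤ 1) : |∫ x, F x ∂μ - ∫ x, F x ∂ν| ≤ blDist μ ν := by
  refine le_ciSup (f := fun F : {F : S → ℝ // blNorm F ≤ 1} =>
    |∫ x, F.1 x ∂μ - ∫ x, F.1 x ∂ν|) ⟨2, ?_⟩ ⟨F, hF⟩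
  rintro _ ⟨G, rfl⟩
  have h1 := abs_integral_le_one μ (abs_le_one_of_blNorm_le G.2)
  have h2 := abs_integral_le_one ν (abs_le_one_of_blNorm_le G.2)
  exact (abs_sub _ _).trans (by linarith)

end BoundedLipschitz

/-- Translating one of the laws by `h` changes the bounded Lipschitz distance by at most `‖h‖`. -/
lemma blDist_map_add_le {E : Type*} [NormedAddCommGroup E] [MeasurableSpace E] [BorelSpace E]
    (μ ν : Measure E) [IsProbabilityMeasure μ] [IsProbabilityMeasure ν] (h : E) :
    blDist (μ.map fun x => x + h) ν ≤ ‖h‖ + blDist μ ν := by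
  refine blDist_le fun F hF => ?_
  have hc := continuous_of_blNorm_le hF
  have hm : Measurable F := hc.measurable
  have hma : Measurable fun x : E => x + h := (continuous_add_const h).measurable
  rw [integral_map hma.aemeasurable hc.aestronglyMeasurable]
  have hi1 := integrable_of_measurable_of_bound μ (hm.comp hma)
    fun x => abs_le_one_of_blNorm_le hF (x + h)
  have hi2 := integrable_of_measurable_of_bound μ hm (abs_le_one_of_blNorm_le hF)
  have h1 : |∫ x, F (x + h) ∂μ - ∫ x, F x ∂μ| ≤ ‖h‖ := by
    simp only [Function.comp_def] at hi1
    rw [← integral_sub hi1 hi2]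
    have h2 : ∀ x, ‖F (x + h) - F x‖ ≤ ‖h‖ := fun x => by
      refine (abs_sub_le_dist_of_blNorm_le hF (x + h) x).trans ?_
      rw [dist_eq_norm, add_sub_cancel_left]
    simpa using norm_integral_le_of_norm_le_const (μ := μ) (ae_of_all _ h2)
  have h2 := le_blDist (μ := μ) (ν := ν) hF
  calc _ = |(∫ x, F (x + h) ∂μ - ∫ x, F x ∂μ) + (∫ x, F x ∂μ - ∫ x, F x ∂ν)| := by
        congr 1; ring
    _ ≤ _ := (abs_add_le _ _).trans (add_le_add h1 h2)

section Truncation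

variable {J₀ K₀ : ℕ} {w : Weight J₀}

/-- The sequences with a coefficient outside of `s` that exceeds `δ w_l`. -/
def tailSet (w : Weight J₀) (s : Finset (Index J₀ K₀)) (δ : ℝ) : Set (Index J₀ K₀ → ℝ) :=
  {x | ∃ i ∉ s, δ * w (level i) < |x i|}

lemma measurableSet_tailSet (s : Finset (Index J₀ K₀)) (δ : ℝ) :
    MeasurableSet (tailSet w s δ) := by
  have h : tailSet w s δ = ⋃ i, ⋃ _ : i ∉ s, {x | δ * w (level i) < |x i|} := by
    ext x; simp [tailSet]
  rw [h]
  exact MeasurableSet.iUnion fun i => MeasurableSet.iUnion fun _ =>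
    measurableSet_lt measurable_const (by fun_prop)

lemma abs_integral_toM0_sub_truncM0_le (μ : Measure (Index J₀ K₀ → ℝ)) [IsProbabilityMeasure μ]
    (hμ : ∀ᵐ x ∂μ, x ∈ M0Submodule K₀ w) (s : Finset (Index J₀ K₀)) {δ : ℝ} (hδ : 0 ≤ δ)
    {F : M0 K₀ w → ℝ} (hF : blNorm F ≤ 1) :
    |∫ x, F (toM0 w x) ∂μ - ∫ x, F (truncM0 w s x) ∂μ| ≤ δ + 2 * μ.real (tailSet w s δ) := by
  have hm : Measurable F := (continuous_of_blNorm_le hF).measurable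
  have hb := abs_le_one_of_blNorm_le hF
  have hi1 := integrable_of_measurable_of_bound μ (hm.comp measurable_toM0) fun x => hb _
  have hi2 := integrable_of_measurable_of_bound μ
    (hm.comp (continuous_truncM0 (w := w) s).measurable) fun x => hb _
  have hms := measurableSet_tailSet (w := w) s δ
  have hind : Integrable ((tailSet w s δ).indicator (1 : (Index J₀ K₀ → ℝ) → ℝ)) μ :=
    (integrable_const (1 : ℝ)).indicator hms
  have hi3 : Integrable (fun x => δ + 2 * (tailSet w s δ).indicator 1 x) μ :=
    (integrable_const δ).add (hind.const_mul 2)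
  have h1 : ∫ x, (δ + 2 * (tailSet w s δ).indicator (1 : (Index J₀ K₀ → ℝ) → ℝ) x) ∂μ =
      δ + 2 * μ.real (tailSet w s δ) := by
    rw [integral_add (integrable_const δ) (hind.const_mul 2), integral_const_mul,
      integral_indicator_one hms]
    simp
  simp only [Function.comp_def] at hi1 hi2
  rw [← integral_sub hi1 hi2, ← h1]
  refine (abs_integral_le_integral_abs).trans (integral_mono_ae (hi1.sub hi2).abs hi3 ?_)
  filter_upwards [hμ] with x hx
  by_cases hxt : x ∈ tailSet w s δ
  · rw [Set.indicator_of_mem hxt, Pi.one_apply]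
    have h2 := abs_sub (F (toM0 w x)) (F (truncM0 w s x))
    have h3 := hb (toM0 w x)
    have h4 := hb (truncM0 w s x)
    linarith
  · rw [Set.indicator_of_notMem hxt, mul_zero, add_zero]
    refine (abs_sub_le_dist_of_blNorm_le hF _ _).trans ?_
    rw [dist_eq_norm]
    refine norm_toM0_sub_truncM0_le hx hδ fun i hi => ?_
    by_contra hcon
    exact hxt ⟨i, hi, not_le.1 hcon⟩

/-- Weak convergence in `M₀(w)` splits into the convergence of finitely many coefficients and a
uniform control of the others. -/
lemma blDist_map_toM0_le (μ ν : Measure (Index J₀ K₀ → ℝ)) [IsProbabilityMeasure μ]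
    [IsProbabilityMeasure ν] (hμ : ∀ᵐ x ∂μ, x ∈ M0Submodule K₀ w)
    (hν : ∀ᵐ x ∂ν, x ∈ M0Submodule K₀ w) (s : Finset (Index J₀ K₀)) {δ η : ℝ} (hδ : 0 ≤ δ)
    (hη : ∀ F : M0 K₀ w → ℝ, Continuous F → (∀ x, |F x| ≤ 1) →
      |∫ x, F (truncM0 w s x) ∂μ - ∫ x, F (truncM0 w s x) ∂ν| ≤ η) :
    blDist (μ.map (toM0 w)) (ν.map (toM0 w)) ≤
      2 * δ + 2 * μ.real (tailSet w s δ) + 2 * ν.real (tailSet w s δ) + η := by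
  refine blDist_le fun F hF => ?_
  have hc := continuous_of_blNorm_le hF
  rw [integral_map measurable_toM0.aemeasurable hc.aestronglyMeasurable,
    integral_map measurable_toM0.aemeasurable hc.aestronglyMeasurable]
  have h1 := abs_le.1 (abs_integral_toM0_sub_truncM0_le μ hμ s hδ hF)
  have h2 := abs_le.1 (abs_integral_toM0_sub_truncM0_le ν hν s hδ hF)
  have h3 := abs_le.1 (hη F hc (abs_le_one_of_blNorm_le hF))
  rw [abs_le]
  constructor <;> linarith [h1.1, h1.2, h2.1, h2.2, h3.1, h3.2]

end Truncation

/-- Two product measures differ, on functions of the coordinates in `s`, by at most the `L¹`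
distance of the density of these coordinates from `1`. -/
lemma abs_integral_infinitePi_sub_le {ι Ω : Type*} [MeasurableSpace Ω] (μ ν : ι → Measure Ω)
    [∀ i, IsProbabilityMeasure (μ i)] [∀ i, IsProbabilityMeasure (ν i)] (r : ι → Ω → ℝ≥0∞)
    (hr : ∀ i, Measurable (r i)) (h : ∀ i, ν i = (μ i).withDensity (r i)) (s : Finset ι)
    {H : (ι → Ω) → ℝ} (hH : Measurable H) (hH1 : ∀ x, |H x| ≤ 1)
    (hHs : ∀ x y, (∀ i ∈ s, x i = y i) → H x = H y) :
    |∫ x, H x ∂Measure.infinitePi ν - ∫ x, H x ∂Measure.infinitePi μ| ≤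
      (∫⁻ x, ENNReal.ofReal |(∏ i ∈ s, (r i (x i)).toReal) - 1| ∂Measure.infinitePi μ).toReal := by
  classical
  rcases isEmpty_or_nonempty (ι → Ω) with he | ⟨⟨x₀⟩⟩
  · have h0 : ∀ κ : Measure (ι → Ω), κ = 0 := fun κ => Measure.eq_zero_of_isEmpty κ
    rw [h0 (Measure.infinitePi ν), h0 (Measure.infinitePi μ)]
    simp
  have hpr : ∀ i, IsProbabilityMeasure (s.piecewise ν μ i) := fun i => by
    by_cases hi : i ∈ s <;> simp only [hi, Finset.piecewise, if_true, if_false] <;> infer_instance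
  set ext : (s → Ω) → ι → Ω := fun y i => if hi : i ∈ s then y ⟨i, hi⟩ else x₀ i with hext
  have hme : Measurable ext := measurable_pi_lambda _ fun i => by
    by_cases hi : i ∈ s <;> simp only [hext, hi, dite_true, dite_false] <;> fun_prop
  have hfac : ∀ x, H x = H (ext (s.restrict x)) := fun x => hHs _ _ fun i hi => by
    simp [hext, hi]
  have h1 : ∫ x, H x ∂Measure.infinitePi ν =
      ∫ x, H x ∂Measure.infinitePi (s.piecewise ν μ) := by
    have h2 : ∀ κ : Measure (ι → Ω), ∫ x, H x ∂κ = ∫ y, H (ext y) ∂(κ.map s.restrict) := by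
      intro κ
      rw [integral_map (Finset.measurable_restrict s).aemeasurable
        (hH.comp hme).aestronglyMeasurable]
      exact integral_congr_ae (ae_of_all _ hfac)
    rw [h2, h2, infinitePi_piecewise_preimage_cylinder]
  have hmp : Measurable fun x : ι → Ω => ∏ i ∈ s, r i (x i) :=
    Finset.measurable_fun_prod _ fun i _ => (hr i).comp (measurable_pi_apply i)
  have hint : ∫⁻ x, ∏ i ∈ s, r i (x i) ∂Measure.infinitePi μ = 1 := by
    rw [lintegral_infinitePi_prod μ s r hr]
    refine Finset.prod_eq_one fun i _ => ?_
    have := measure_univ (μ := ν i)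
    rwa [h i, withDensity_apply _ MeasurableSet.univ, Measure.restrict_univ] at this
  have hne : ∫⁻ x, ∏ i ∈ s, r i (x i) ∂Measure.infinitePi μ ≠ ∞ := by
    rw [hint]; exact ENNReal.one_ne_top
  rw [h1, ← infinitePi_withDensity_finset μ ν r hr h s,
    integral_withDensity_eq_integral_toReal_smul hmp (ae_lt_top hmp hne)]
  have hi1 : Integrable (fun x => (∏ i ∈ s, r i (x i)).toReal) (Measure.infinitePi μ) :=
    integrable_toReal_of_lintegral_ne_top hmp.aemeasurable hne
  have hi2 : Integrable (fun x => (∏ i ∈ s, r i (x i)).toReal • H x) (Measure.infinitePi μ) :=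
    hi1.mul_bdd (c := 1) hH.aestronglyMeasurable (ae_of_all _ hH1)
  have hi3 : Integrable H (Measure.infinitePi μ) :=
    integrable_of_measurable_of_bound _ hH hH1
  rw [← integral_sub hi2 hi3]
  simp only [ENNReal.toReal_prod] at hi1 hi2 ⊢
  refine (abs_integral_le_integral_abs).trans ?_
  have hi4 := (hi1.sub (integrable_const (1 : ℝ))).abs
  simp only [Pi.sub_apply] at hi4
  rw [← integral_eq_lintegral_of_nonneg_ae (ae_of_all _ fun x => abs_nonneg _)
    hi4.aestronglyMeasurable]
  refine integral_mono (hi2.sub hi3).abs hi4 fun x => ?_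
  simp only [smul_eq_mul]
  calc |(∏ i ∈ s, (r i (x i)).toReal) * H x - H x|
      = |(∏ i ∈ s, (r i (x i)).toReal) - 1| * |H x| := by rw [← abs_mul]; congr 1; ring
    _ ≤ _ := mul_le_of_le_one_right (abs_nonneg _) (hH1 x)

/-! ### The prior and the posterior as products over the indices -/

section ProductForm

variable {J₀ K₀ : ℕ}

/-- The noise level `1 / √n`. -/
def noiseLevel (n : ℕ) : ℝ := (√(n : ℝ))⁻¹

lemma noiseLevel_pos {n : ℕ} (hn : 1 ≤ n) : 0 < noiseLevel n :=
  inv_pos.2 (Real.sqrt_pos.2 (by exact_mod_cast hn))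

lemma sqrt_mul_noiseLevel {n : ℕ} (hn : 1 ≤ n) : √(n : ℝ) * noiseLevel n = 1 :=
  mul_inv_cancel₀ (Real.sqrt_pos.2 (by exact_mod_cast hn)).ne'

lemma priorScale_pos (α : ℝ) (l : ℤ) : 0 < priorScale α l := Real.rpow_pos_of_pos two_pos _

lemma infinitePi_congr {ι Ω : Type*} [MeasurableSpace Ω] {μ ν : ι → Measure Ω}
    [∀ i, IsProbabilityMeasure (μ i)] [∀ i, IsProbabilityMeasure (ν i)] (h : ∀ i, μ i = ν i) :
    Measure.infinitePi μ = Measure.infinitePi ν := by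
  obtain rfl : μ = ν := funext h
  rfl

lemma posterior_congr {Ω X : Type*} [MeasurableSpace Ω] [StandardBorelSpace Ω] [Nonempty Ω]
    [MeasurableSpace X] {κ κ' : Kernel Ω X} {μ μ' : Measure Ω} [IsFiniteKernel κ]
    [IsFiniteKernel κ'] [IsFiniteMeasure μ] [IsFiniteMeasure μ'] (hκ : κ = κ') (hμ : μ = μ') :
    posterior κ μ = posterior κ' μ' := by
  subst hκ hμ
  rfl

lemma model_eq_productKernel (n : ℕ) :
    model J₀ K₀ n = productKernel fun _ => coordModel (noiseLevel n) := by
  refine Kernel.ext fun f => ?_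
  rw [model_apply, productKernel_apply, whiteNoise]
  have h := Measure.infinitePi_map_pi (fun _ : Index J₀ K₀ => gaussianReal 0 1)
    (f := fun i z => f i + noiseLevel n * z) fun i => by fun_prop
  have : ∀ i, IsProbabilityMeasure ((gaussianReal 0 1).map fun z => f i + noiseLevel n * z) :=
    fun i => Measure.isProbabilityMeasure_map (by fun_prop)
  rw [infinitePi_congr (fun i => coordModel_apply (noiseLevel n) (f i)), ← h]
  rfl

variable (φ : SubGaussianDensity) (α : ℝ)

instance isProbabilityMeasure_withDensity_scaled (l : ℤ) :
    IsProbabilityMeasure (volume.withDensity (φ.scaled (priorScale α l))) := by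
  rw [← φ.law_map_mul (priorScale_pos α l)]
  exact Measure.isProbabilityMeasure_map (by fun_prop)

lemma prior_eq_infinitePi : prior J₀ K₀ α φ = Measure.infinitePi fun i =>
    volume.withDensity (φ.scaled (priorScale α (level i))) := by
  have : ∀ i : Index J₀ K₀, IsProbabilityMeasure
      (φ.law.map fun y => priorScale α (level i) * y) :=
    fun i => Measure.isProbabilityMeasure_map (by fun_prop)
  rw [prior, Measure.infinitePi_map_pi (fun _ : Index J₀ K₀ => φ.law)
    (f := fun i y => priorScale α (level i) * y) fun i => by fun_prop]
  exact infinitePi_congr fun i => φ.law_map_mul (priorScale_pos α (level i))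

variable {φ}

lemma evidence_scaled_ne {b τ : ℝ} (hb : 0 < b) (hτ : 0 < τ) (hφ : ∀ x ∈ Set.Ioo (-τ) τ, b ≤ φ x)
    {r c : ℝ} (hr : 0 < r) (hc : 0 < c) (x : ℝ) :
    evidence (φ.scaled r) c x ≠ 0 ∧ evidence (φ.scaled r) c x ≠ ∞ := by
  have h := φ.evidence_scaled hr.ne' (c := c) 0 (x / c)
  rw [zero_add, mul_div_cancel₀ x hc.ne', zero_div] at h
  have h0 : φ.norming (r / c) 0 (x / c) ≠ 0 :=
    φ.norming_ne_zero hb hτ (by simpa using hφ) (div_pos hr hc) _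
  rw [h]
  exact ⟨ENNReal.div_ne_zero.2 ⟨h0, ENNReal.ofReal_ne_top⟩,
    ENNReal.div_ne_top (φ.norming_ne_top _ _ _) (ENNReal.ofReal_pos.2 hr).ne'⟩

lemma isMarkovKernel_localPost_scaled {b τ : ℝ} (hb : 0 < b) (hτ : 0 < τ)
    (hφ : ∀ x ∈ Set.Ioo (-τ) τ, b ≤ φ x) {r c : ℝ} (hr : 0 < r) (hc : 0 < c) :
    IsMarkovKernel (localPost (φ.scaled r) c) :=
  isMarkovKernel_localPost c (φ.measurable_scaled r)
    (fun x => (evidence_scaled_ne hb hτ hφ hr hc x).1)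
    fun x => (evidence_scaled_ne hb hτ hφ hr hc x).2

variable (φ)

/-- The product of the rescaled posteriors of all coefficients at the observation `x`: this is the
law of `√n (f - x)` under the posterior. -/
def localLaw (n : ℕ) (x : Index J₀ K₀ → ℝ)
    [∀ i : Index J₀ K₀, IsMarkovKernel
      (localPost (φ.scaled (priorScale α (level i))) (noiseLevel n))] :
    Measure (Index J₀ K₀ → ℝ) :=
  Measure.infinitePi fun i =>
    localPost (φ.scaled (priorScale α (level i))) (noiseLevel n) (x i)

section

variable {n : ℕ} [∀ i : Index J₀ K₀, IsMarkovKernel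
  (localPost (φ.scaled (priorScale α (level i))) (noiseLevel n))]

instance (x : Index J₀ K₀ → ℝ) : IsProbabilityMeasure (localLaw φ α n x) := by
  unfold localLaw; infer_instance

variable {φ}

/-- The posterior is, up to an affine rescaling, the product of the rescaled posteriors of the
coefficients. -/
theorem ae_post_eq_map_localLaw {b τ : ℝ} (hb : 0 < b) (hτ : 0 < τ)
    (hφ : ∀ x ∈ Set.Ioo (-τ) τ, b ≤ φ x) (hn : 1 ≤ n) :
    ∀ᵐ x ∂(model J₀ K₀ n ∘ₘ prior J₀ K₀ α φ), post (prior J₀ K₀ α φ) n x =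
      (localLaw φ α n x).map fun z => x + noiseLevel n • z := by
  have hpost : posterior (model J₀ K₀ n) (prior J₀ K₀ α φ) =
      posterior (productKernel fun _ => coordModel (noiseLevel n)) (Measure.infinitePi fun i =>
        volume.withDensity (φ.scaled (priorScale α (level i)))) :=
    posterior_congr (model_eq_productKernel n) (prior_eq_infinitePi φ α)
  have h := posterior_productKernel
    (fun i : Index J₀ K₀ => volume.withDensity (φ.scaled (priorScale α (level i))))
    (fun _ => coordModel (noiseLevel n))
    (fun i => coordPost (φ.scaled (priorScale α (level i))) (noiseLevel n)) fun i =>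
      coordPost_compProd (noiseLevel n) (φ.measurable_scaled _)
        (fun x => (evidence_scaled_ne hb hτ hφ (priorScale_pos α _) (noiseLevel_pos hn) x).1)
        (fun x => (evidence_scaled_ne hb hτ hφ (priorScale_pos α _) (noiseLevel_pos hn) x).2)
  rw [← hpost, ← model_eq_productKernel, ← prior_eq_infinitePi] at h
  filter_upwards [h] with x hx
  rw [post, ← hx, productKernel_apply, localLaw]
  have h1 := Measure.infinitePi_map_pi
    (fun i : Index J₀ K₀ => localPost (φ.scaled (priorScale α (level i))) (noiseLevel n) (x i))
    (f := fun i z => x i + noiseLevel n * z) fun i => by fun_prop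
  have : ∀ i : Index J₀ K₀, IsProbabilityMeasure
      ((localPost (φ.scaled (priorScale α (level i))) (noiseLevel n) (x i)).map
        fun z => x i + noiseLevel n * z) :=
    fun i => Measure.isProbabilityMeasure_map (by fun_prop)
  rw [infinitePi_congr (fun i => coordPost_apply (noiseLevel n) (x i)), ← h1]
  rfl

end

end ProductForm

/-! ### Square summability under the prior and the posterior -/

section SquareSummable

variable {J₀ K₀ : ℕ}

/-- The squared `ℓ²` norm of a sequence. -/
def sqNorm (x : Index J₀ K₀ → ℝ) : ℝ≥0∞ := ∑' i, ENNReal.ofReal (x i ^ 2)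

lemma measurable_sqNorm : Measurable (sqNorm : (Index J₀ K₀ → ℝ) → ℝ≥0∞) :=
  Measurable.tsum fun i => by fun_prop

lemma summable_of_sqNorm_ne_top {x : Index J₀ K₀ → ℝ} (hx : sqNorm x ≠ ∞) :
    Summable fun i => x i ^ 2 := by
  have h := ENNReal.summable_toReal hx
  simpa [ENNReal.toReal_ofReal (sq_nonneg _)] using h

lemma summable_priorScale_sq {α : ℝ} (hα : 0 < α) :
    Summable fun i : Index J₀ K₀ => priorScale α (level i) ^ 2 := by
  refine summable_index (F := fun l => priorScale α l ^ 2) (fun l => sq_nonneg _) ?_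
  have h1 : ∀ j : ℕ, (2 : ℝ) ^ (J₀ + j) * priorScale α ((J₀ : ℤ) + j) ^ 2 =
      ((2 : ℝ) ^ (-(2 * α))) ^ (J₀ + j) := by
    intro j
    rw [priorScale, ← Real.rpow_natCast, ← Real.rpow_natCast, ← Real.rpow_natCast,
      ← Real.rpow_mul two_pos.le, ← Real.rpow_mul two_pos.le, ← Real.rpow_add two_pos]
    congr 1
    push_cast
    ring
  simp_rw [h1, pow_add]
  refine (summable_geometric_of_lt_one (by positivity) ?_).mul_left _
  exact Real.rpow_lt_one_of_one_lt_of_neg one_lt_two (by linarith)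

lemma lintegral_sqNorm_prior_ne_top (φ : SubGaussianDensity) {α : ℝ} (hα : 0 < α) :
    ∫⁻ f, sqNorm f ∂prior J₀ K₀ α φ ≠ ∞ := by
  have hm : Measurable fun (x : Index J₀ K₀ → ℝ) i => priorScale α (level i) * x i := by fun_prop
  have h1 : ∀ i : Index J₀ K₀, ∫⁻ x, ENNReal.ofReal ((priorScale α (level i) * x i) ^ 2)
      ∂Measure.infinitePi (fun _ : Index J₀ K₀ => φ.law) =
      ENNReal.ofReal (priorScale α (level i) ^ 2) * ∫⁻ y, ENNReal.ofReal (y ^ 2) ∂φ.law := by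
    intro i
    have h2 := lintegral_map (μ := Measure.infinitePi fun _ : Index J₀ K₀ => φ.law)
      (f := fun y : ℝ => ENNReal.ofReal (y ^ 2)) (by fun_prop) (measurable_pi_apply i)
    rw [Measure.infinitePi_map_eval (fun _ : Index J₀ K₀ => φ.law) i] at h2
    rw [h2, ← lintegral_const_mul _ (by fun_prop)]
    refine lintegral_congr fun x => ?_
    rw [mul_pow, ENNReal.ofReal_mul (sq_nonneg _)]
  rw [prior, lintegral_map measurable_sqNorm hm]
  simp only [sqNorm]
  rw [lintegral_tsum fun i => ((((measurable_pi_apply i).const_mul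
    (priorScale α (level i))).pow_const 2).ennreal_ofReal).aemeasurable]
  simp_rw [h1]
  rw [ENNReal.tsum_mul_right]
  exact ENNReal.mul_ne_top (summable_priorScale_sq hα).tsum_ofReal_ne_top φ.lintegral_sq_ne_top

/-- The law of the data under a square summable truth is absolutely continuous with respect to
their marginal law, so that the posterior is determined almost surely. -/
lemma model_absolutelyContinuous_marginal (φ : SubGaussianDensity) {α : ℝ} (hα : 0 < α) {n : ℕ}
    (hn : 1 ≤ n) {f₀ : Index J₀ K₀ → ℝ} (hf₀ : Summable fun i => f₀ i ^ 2) :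
    model J₀ K₀ n f₀ ≪ model J₀ K₀ n ∘ₘ prior J₀ K₀ α φ := by
  refine Measure.AbsolutelyContinuous.mk fun A hA hA0 => ?_
  rw [Measure.bind_apply hA (Kernel.aemeasurable _), lintegral_eq_zero_iff
    ((model J₀ K₀ n).measurable_coe hA)] at hA0
  have h1 := ae_lt_top measurable_sqNorm (lintegral_sqNorm_prior_ne_top (J₀ := J₀) (K₀ := K₀) φ hα)
  obtain ⟨f, hfA, hf⟩ := (hA0.and h1).exists
  refine model_absolutelyContinuous hn f₀ f ?_ hfA
  have h2 := summable_of_sqNorm_ne_top hf.ne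
  refine Summable.of_nonneg_of_le (fun i => sq_nonneg _) (fun i => ?_)
    ((hf₀.add h2).mul_left 2)
  nlinarith [sq_nonneg (f₀ i + f i)]

lemma ae_lintegral_sqNorm_post_ne_top (φ : SubGaussianDensity) {α : ℝ} (hα : 0 < α) {n : ℕ} :
    ∀ᵐ x ∂(model J₀ K₀ n ∘ₘ prior J₀ K₀ α φ),
      ∫⁻ f, sqNorm f ∂post (prior J₀ K₀ α φ) n x ≠ ∞ := by
  have h := lintegral_sqNorm_prior_ne_top (J₀ := J₀) (K₀ := K₀) φ hα
  rw [← posterior_comp_self (κ := model J₀ K₀ n) (μ := prior J₀ K₀ α φ),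
    Measure.lintegral_bind (Kernel.aemeasurable _) measurable_sqNorm.aemeasurable] at h
  have hm : Measurable fun x => ∫⁻ f, sqNorm f
      ∂posterior (model J₀ K₀ n) (prior J₀ K₀ α φ) x := measurable_sqNorm.lintegral_kernel
  filter_upwards [ae_lt_top hm h] with x hx using hx.ne

instance (Q : Measure (Index J₀ K₀ → ℝ)) [IsProbabilityMeasure Q] (n : ℕ)
    (x : Index J₀ K₀ → ℝ) : IsProbabilityMeasure (post Q n x) := by
  unfold post; infer_instance

lemma ae_summable_sq {μ : Measure (Index J₀ K₀ → ℝ)} (hμ : ∫⁻ f, sqNorm f ∂μ ≠ ∞) :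
    ∀ᵐ f ∂μ, Summable fun i => f i ^ 2 := by
  filter_upwards [ae_lt_top measurable_sqNorm hμ] with f hf using summable_of_sqNorm_ne_top hf.ne

lemma memℓp_two_of_summable_sq {f : Index J₀ K₀ → ℝ} (hf : Summable fun i => f i ^ 2) :
    Memℓp f 2 := by
  refine (memℓp_gen_iff (by norm_num)).2 ?_
  simpa using hf

lemma integrable_id_map_toM0 {w : Weight J₀} {μ : Measure (Index J₀ K₀ → ℝ)}
    [IsProbabilityMeasure μ] (hμ : ∫⁻ f, sqNorm f ∂μ ≠ ∞) :
    Integrable (fun f => f) (μ.map (toM0 w)) := by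
  change Integrable id _
  rw [integrable_map_measure aestronglyMeasurable_id measurable_toM0.aemeasurable]
  refine ⟨stronglyMeasurable_toM0.aestronglyMeasurable, ?_⟩
  have h1 : ∫⁻ f, (1 + sqNorm f) ∂μ ≠ ∞ := by
    rw [lintegral_add_left measurable_const, lintegral_const, measure_univ]
    exact ENNReal.add_ne_top.2 ⟨by simp, hμ⟩
  refine lt_of_le_of_lt (lintegral_mono_ae ?_) h1.lt_top
  filter_upwards [ae_summable_sq hμ] with f hf
  have h2 : sqNorm f = ENNReal.ofReal (∑' i, f i ^ 2) :=
    (ENNReal.ofReal_tsum_of_nonneg (fun i => sq_nonneg _) hf).symm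
  have h3 : 0 ≤ ∑' i, f i ^ 2 := tsum_nonneg fun i => sq_nonneg _
  rw [h2, ← ENNReal.ofReal_one, ← ENNReal.ofReal_add zero_le_one h3, Function.comp_apply,
    ← ofReal_norm, id_eq]
  refine ENNReal.ofReal_le_ofReal (M0.norm_le (by linarith) fun i => ?_)
  rw [coeff_toM0 (mem_M0Submodule_of_summable_sq hf)]
  have h4 : f i ^ 2 ≤ ∑' i, f i ^ 2 := hf.le_tsum i fun j _ => sq_nonneg _
  have h5 : |f i| ≤ 1 + f i ^ 2 := by
    rw [← sq_abs]
    nlinarith [sq_nonneg (|f i| - 1), abs_nonneg (f i)]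
  exact (h5.trans (by linarith)).trans (le_mul_of_one_le_right (by linarith)
    (w.one_le _ (le_level i)))

end SquareSummable

/-! ### The weak Bernstein-von Mises phenomenon in the noise variable -/

section Convergence

variable {J₀ K₀ : ℕ}

/-- Gaussian tail bounds for the coefficients outside of a finite set, by a union bound. -/
lemma infinitePi_tailSet_le {w : Weight J₀} (μ : Index J₀ K₀ → Measure ℝ)
    [∀ i, IsProbabilityMeasure (μ i)] (s : Finset (Index J₀ K₀)) {δ : ℝ} (hδ : 0 ≤ δ) :
    Measure.infinitePi μ (tailSet w s δ) ≤ ∑' i : {i // i ∉ s},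
      ENNReal.ofReal (Real.exp (-(δ ^ 2 / 4 * w (level i.1) ^ 2))) *
        ∫⁻ z, ENNReal.ofReal (Real.exp (z ^ 2 / 4)) ∂μ i.1 := by
  have h1 : tailSet w s δ ⊆ ⋃ i : {i // i ∉ s}, {x | δ * w (level i.1) < |x i.1|} := by
    rintro x ⟨i, hi, hx⟩
    exact Set.mem_iUnion.2 ⟨⟨i, hi⟩, hx⟩
  refine (measure_mono h1).trans ((measure_iUnion_le _).trans (ENNReal.tsum_le_tsum fun i => ?_))
  have h2 := measure_lt_abs_le (μ i.1) (t := δ * w (level i.1)) (mul_nonneg hδ (w.pos _).le)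
  have h3 : Measure.infinitePi μ {x | δ * w (level i.1) < |x i.1|} =
      μ i.1 {z | δ * w (level i.1) < |z|} := by
    rw [← Measure.infinitePi_map_eval μ i.1, Measure.map_apply (measurable_pi_apply i.1)
      (measurableSet_lt (by fun_prop) (by fun_prop))]
    rfl
  rw [h3]
  refine h2.trans (le_of_eq ?_)
  congr 4
  ring

lemma lintegral_eval_whiteNoise (i : Index J₀ K₀) {F : ℝ → ℝ≥0∞} (hF : Measurable F) :
    ∫⁻ g, F (g i) ∂whiteNoise J₀ K₀ = ∫⁻ z, F z ∂gaussianReal 0 1 := by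
  have h := lintegral_map (μ := whiteNoise J₀ K₀) hF (measurable_pi_apply i)
  rw [whiteNoise, Measure.infinitePi_map_eval (fun _ : Index J₀ K₀ => gaussianReal 0 1) i] at h
  exact h.symm

/-- The prior scale at an index in units of the noise level. -/
def ratio (α : ℝ) (n : ℕ) (i : Index J₀ K₀) : ℝ := priorScale α (level i) / noiseLevel n

lemma ratio_pos {α : ℝ} {n : ℕ} (hn : 1 ≤ n) (i : Index J₀ K₀) : 0 < ratio α n i :=
  div_pos (priorScale_pos α _) (noiseLevel_pos hn)

lemma tendsto_ratio (α : ℝ) (i : Index J₀ K₀) :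
    Tendsto (fun n => ratio α n i) atTop atTop := by
  simp only [ratio, noiseLevel, div_inv_eq_mul]
  exact (Real.tendsto_sqrt_atTop.comp tendsto_natCast_atTop_atTop).const_mul_atTop
    (priorScale_pos α _)

/-- The coefficients of the truth in units of the prior scale. -/
def relTruth (α : ℝ) (f₀ : Index J₀ K₀ → ℝ) (i : Index J₀ K₀) : ℝ :=
  f₀ i / priorScale α (level i)

/-- The assumptions on the prior density and on the truth: `φ` is continuous and at
least `b` on `(-τ, τ)`, and the coefficients of the truth are at most `M < τ` prior scales. -/
structure Compatible (φ : SubGaussianDensity) (α : ℝ) (f₀ : Index J₀ K₀ → ℝ) (M τ b : ℝ) :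
    Prop where
  M_pos : 0 < M
  lt : M < τ
  b_pos : 0 < b
  cont : ContinuousOn φ (Set.Ioo (-τ) τ)
  le_dens : ∀ x ∈ Set.Ioo (-τ) τ, b ≤ φ x
  abs_relTruth_le : ∀ i, |relTruth α f₀ i| ≤ M

namespace Compatible

variable {φ : SubGaussianDensity} {α : ℝ} {f₀ : Index J₀ K₀ → ℝ} {M τ b : ℝ}

lemma mem_Ioo (H : Compatible φ α f₀ M τ b) (i : Index J₀ K₀) : relTruth α f₀ i ∈ Set.Ioo (-τ) τ :=
  abs_lt.1 ((H.abs_relTruth_le i).trans_lt H.lt)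

lemma continuousAt (H : Compatible φ α f₀ M τ b) (i : Index J₀ K₀) : ContinuousAt φ (relTruth α f₀ i) :=
  H.cont.continuousAt (isOpen_Ioo.mem_nhds (H.mem_Ioo i))

lemma dens_pos (H : Compatible φ α f₀ M τ b) (i : Index J₀ K₀) : 0 < φ (relTruth α f₀ i) :=
  H.b_pos.trans_le (H.le_dens _ (H.mem_Ioo i))

lemma norming_ne_zero (H : Compatible φ α f₀ M τ b)
    {n : ℕ} (hn : 1 ≤ n) (i : Index J₀ K₀) (g : ℝ) :
    φ.norming (ratio α n i) (relTruth α f₀ i) g ≠ 0 := by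
  have h := abs_le.1 (H.abs_relTruth_le i)
  exact φ.norming_ne_zero H.b_pos (sub_pos.2 H.lt)
    (fun x hx => H.le_dens x ⟨by linarith [hx.1], by linarith [hx.2]⟩) (ratio_pos hn i) g

lemma isMarkovKernel (H : Compatible φ α f₀ M τ b)
    {n : ℕ} (hn : 1 ≤ n) (i : Index J₀ K₀) :
    IsMarkovKernel (localPost (φ.scaled (priorScale α (level i))) (noiseLevel n)) :=
  isMarkovKernel_localPost_scaled H.b_pos (H.M_pos.trans H.lt) H.le_dens (priorScale_pos α _)
    (noiseLevel_pos hn)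

end Compatible

lemma localPost_scaled_apply (φ : SubGaussianDensity) (α : ℝ) (f₀ : Index J₀ K₀ → ℝ) (n : ℕ)
    (i : Index J₀ K₀) (g : ℝ) :
    localPost (φ.scaled (priorScale α (level i))) (noiseLevel n) (f₀ i + noiseLevel n * g) =
      (gaussianReal 0 1).withDensity (φ.stdDensity (ratio α n i) (relTruth α f₀ i) g) := by
  rw [localPost_apply _ (φ.measurable_scaled _)]
  congr 1
  funext z
  exact φ.localDensity_scaled (priorScale_pos α _) _ _ _

variable (φ : SubGaussianDensity) (α : ℝ) (f₀ : Index J₀ K₀ → ℝ)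

/-- The `L¹` distance between `1` and the posterior density of the rescaled coefficients in `s`,
given the noise `g`. -/
def densityError (n : ℕ) (s : Finset (Index J₀ K₀)) (g : Index J₀ K₀ → ℝ) : ℝ≥0∞ :=
  ∫⁻ x, ENNReal.ofReal
    |(∏ i ∈ s, (φ.stdDensity (ratio α n i) (relTruth α f₀ i) (g i) (x i)).toReal) - 1|
      ∂whiteNoise J₀ K₀

/-- The bound on the posterior probability of `tailSet w s δ`, given the noise `g`. -/
def tailBound (w : Weight J₀) (n : ℕ) (s : Finset (Index J₀ K₀)) (δ : ℝ)
    (g : Index J₀ K₀ → ℝ) : ℝ≥0∞ :=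
  ∑' i : {i // i ∉ s}, ENNReal.ofReal (Real.exp (-(δ ^ 2 / 4 * w (level i.1) ^ 2))) *
    φ.expMoment (ratio α n i.1) (relTruth α f₀ i.1) (g i.1)

lemma measurable_densityError (n : ℕ) (s : Finset (Index J₀ K₀)) :
    Measurable (densityError φ α f₀ n s) := by
  have h : Measurable fun p : (Index J₀ K₀ → ℝ) × (Index J₀ K₀ → ℝ) => ENNReal.ofReal
      |(∏ i ∈ s, (φ.stdDensity (ratio α n i) (relTruth α f₀ i) (p.1 i) (p.2 i)).toReal) - 1| := by
    have h2 : ∀ i, Measurable fun p : (Index J₀ K₀ → ℝ) × (Index J₀ K₀ → ℝ) =>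
        (φ.stdDensity (ratio α n i) (relTruth α f₀ i) (p.1 i) (p.2 i)).toReal := fun i => by
      have h1 : Measurable fun p : (Index J₀ K₀ → ℝ) × (Index J₀ K₀ → ℝ) => (p.1 i, p.2 i) := by
        fun_prop
      exact ((φ.measurable_stdDensity (ratio α n i) (relTruth α f₀ i)).comp h1).ennreal_toReal
    fun_prop
  exact h.lintegral_prod_right'

lemma measurable_tailBound (w : Weight J₀) (n : ℕ) (s : Finset (Index J₀ K₀)) (δ : ℝ) :
    Measurable (tailBound φ α f₀ w n s δ) :=
  Measurable.tsum fun i => ((φ.measurable_expMoment _ _).comp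
    (measurable_pi_apply i.1)).const_mul _

variable {φ α f₀}

lemma tendsto_densityError {M τ b : ℝ} (H : Compatible φ α f₀ M τ b) (s : Finset (Index J₀ K₀))
    (g : Index J₀ K₀ → ℝ) : Tendsto (fun n => densityError φ α f₀ n s g) atTop (𝓝 0) := by
  choose D hD0 hD using fun i : Index J₀ K₀ =>
    SubGaussianDensity.eventually_stdDensity_le (H.continuousAt i) (tendsto_ratio α i)
      (H.dens_pos i) (g i)
  have h0 : ∫⁻ _ : Index J₀ K₀ → ℝ, ENNReal.ofReal |(1 : ℝ) - 1| ∂whiteNoise J₀ K₀ = 0 := by simp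
  rw [← h0]
  refine tendsto_lintegral_filter_of_dominated_convergence
    (fun _ => ENNReal.ofReal ((∏ i ∈ s, D i) + 1)) (Eventually.of_forall fun n => ?_) ?_
    (by simp) (ae_of_all _ fun x => ?_)
  · have h1 : ∀ i, Measurable
        (φ.stdDensity (ratio α n i) (relTruth α f₀ i) (g i)) :=
      fun i => φ.measurable_stdDensity_right _ _ _
    fun_prop
  · filter_upwards [(eventually_all_finset s).2 fun i _ => hD i] with n hn
    refine ae_of_all _ fun x => ENNReal.ofReal_le_ofReal ?_
    have h1 : ∏ i ∈ s, (φ.stdDensity (ratio α n i) (relTruth α f₀ i) (g i) (x i)).toReal ≤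
        ∏ i ∈ s, D i :=
      Finset.prod_le_prod (fun i _ => ENNReal.toReal_nonneg) fun i hi => hn i hi _
    have h2 : 0 ≤ ∏ i ∈ s, (φ.stdDensity (ratio α n i) (relTruth α f₀ i) (g i) (x i)).toReal :=
      Finset.prod_nonneg fun i _ => ENNReal.toReal_nonneg
    rw [abs_le]
    constructor <;> linarith
  · have h1 : Tendsto (fun n => ∏ i ∈ s,
        (φ.stdDensity (ratio α n i) (relTruth α f₀ i) (g i) (x i)).toReal) atTop
        (𝓝 (∏ _ ∈ s, (1 : ℝ))) := tendsto_finsetProd _ fun i _ =>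
      SubGaussianDensity.tendsto_stdDensity (H.continuousAt i) (tendsto_ratio α i)
        (H.dens_pos i) (g i) (x i)
    rw [Finset.prod_const_one] at h1
    exact ENNReal.tendsto_ofReal (h1.sub_const 1).abs

/-- The distance between the rescaled posterior and the law of the white noise, for a fixed value
of the noise: the coefficients in `s` contribute `densityError`, the others tail probabilities. -/
lemma blDist_localLaw_le {w : Weight J₀} (hw : w.Admissible) {n : ℕ}
    [∀ i : Index J₀ K₀, IsMarkovKernel
      (localPost (φ.scaled (priorScale α (level i))) (noiseLevel n))]
    {g : Index J₀ K₀ → ℝ}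
    (hmem : ∀ᵐ z ∂localLaw φ α n (f₀ + noiseLevel n • g), z ∈ M0Submodule K₀ w)
    (s : Finset (Index J₀ K₀)) {δ : ℝ} (hδ : 0 ≤ δ) :
    blDist ((localLaw φ α n (f₀ + noiseLevel n • g)).map (toM0 w))
      ((whiteNoise J₀ K₀).map (toM0 w)) ≤
      2 * δ + 2 * (localLaw φ α n (f₀ + noiseLevel n • g)).real (tailSet w s δ) +
        2 * (whiteNoise J₀ K₀).real (tailSet w s δ) + (densityError φ α f₀ n s g).toReal := by
  refine blDist_map_toM0_le _ _ hmem (ae_whiteNoise_mem hw) s hδ fun F hF hF1 => ?_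
  have h := abs_integral_infinitePi_sub_le (fun _ : Index J₀ K₀ => gaussianReal 0 1)
    (fun i => localPost (φ.scaled (priorScale α (level i))) (noiseLevel n)
      ((f₀ + noiseLevel n • g) i))
    (fun i => φ.stdDensity (ratio α n i) (relTruth α f₀ i) (g i))
    (fun i => φ.measurable_stdDensity_right _ _ _)
    (fun i => localPost_scaled_apply φ α f₀ n i (g i)) s
    (H := fun x => F (truncM0 w s x)) (hF.measurable.comp (continuous_truncM0 s).measurable)
    (fun x => hF1 _) fun x y hxy => ?_
  · exact h
  · simp only [truncM0]
    rw [Finset.sum_congr rfl fun i hi => by rw [hxy i hi]]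

lemma localLaw_tailSet_le (w : Weight J₀) {n : ℕ}
    [∀ i : Index J₀ K₀, IsMarkovKernel
      (localPost (φ.scaled (priorScale α (level i))) (noiseLevel n))]
    (g : Index J₀ K₀ → ℝ) (s : Finset (Index J₀ K₀)) {δ : ℝ} (hδ : 0 ≤ δ) :
    localLaw φ α n (f₀ + noiseLevel n • g) (tailSet w s δ) ≤ tailBound φ α f₀ w n s δ g := by
  refine (infinitePi_tailSet_le _ s hδ).trans (ENNReal.tsum_le_tsum fun i => ?_)
  have h1 := localPost_scaled_apply φ α f₀ n i.1 (g i.1)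
  rw [Pi.add_apply, Pi.smul_apply, smul_eq_mul, h1,
    lintegral_withDensity_eq_lintegral_mul _ (φ.measurable_stdDensity_right _ _ _) (by fun_prop),
    SubGaussianDensity.expMoment]
  simp only [Pi.mul_apply, mul_comm, le_refl]

/-- The Gaussian tails of the coefficients outside of `s`. -/
def tailSum (w : Weight J₀) (δ : ℝ) (s : Finset (Index J₀ K₀)) : ℝ≥0∞ :=
  ∑' i : {i // i ∉ s}, ENNReal.ofReal (Real.exp (-(δ ^ 2 / 4 * w (level i.1) ^ 2)))

lemma tendsto_tailSum {w : Weight J₀} (hw : w.Admissible) {δ : ℝ} (hδ : 0 < δ) :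
    Tendsto (tailSum (K₀ := K₀) w δ) atTop (𝓝 0) :=
  ENNReal.tendsto_tsum_compl_atTop_zero
    (tsum_exp_neg_weight_sq_ne_top (K₀ := K₀) hw (a := δ ^ 2 / 4) (by positivity))

lemma lintegral_tailBound_le (w : Weight J₀) {n : ℕ} (s : Finset (Index J₀ K₀)) (δ : ℝ)
    {K : ℝ≥0∞} (hK : ∀ i : Index J₀ K₀,
      ∫⁻ g, φ.expMoment (ratio α n i) (relTruth α f₀ i) g ∂gaussianReal 0 1 ≤ K) :
    ∫⁻ g, tailBound φ α f₀ w n s δ g ∂whiteNoise J₀ K₀ ≤ tailSum w δ s * K := by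
  have hm : ∀ i : Index J₀ K₀, Measurable (φ.expMoment (ratio α n i) (relTruth α f₀ i)) :=
    fun i => φ.measurable_expMoment _ _
  have hm' : ∀ i : Index J₀ K₀, Measurable fun g : Index J₀ K₀ → ℝ =>
      φ.expMoment (ratio α n i) (relTruth α f₀ i) (g i) :=
    fun i => (hm i).comp (measurable_pi_apply i)
  have h1 : ∫⁻ g, tailBound φ α f₀ w n s δ g ∂whiteNoise J₀ K₀ = ∑' i : {i // i ∉ s},
      ∫⁻ g, ENNReal.ofReal (Real.exp (-(δ ^ 2 / 4 * w (level i.1) ^ 2))) *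
        φ.expMoment (ratio α n i.1) (relTruth α f₀ i.1) (g i.1) ∂whiteNoise J₀ K₀ :=
    lintegral_tsum fun i => ((hm' i.1).const_mul _).aemeasurable
  rw [h1, tailSum, ← ENNReal.tsum_mul_right]
  refine ENNReal.tsum_le_tsum fun i => ?_
  rw [lintegral_const_mul _ (hm' i.1), lintegral_eval_whiteNoise i.1 (hm i.1)]
  exact mul_le_mul_right (hK i.1) _

lemma Compatible.exists_expMoment_le {M τ b : ℝ} (H : Compatible φ α f₀ M τ b) :
    ∃ K : ℝ≥0∞, K ≠ ∞ ∧ ∀ n ≥ 1, ∀ i,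
      ∫⁻ g, φ.expMoment (ratio α n i) (relTruth α f₀ i) g ∂gaussianReal 0 1 ≤ K := by
  obtain ⟨K, hK, h⟩ := φ.exists_lintegral_exp_sq_le H.b_pos H.lt H.le_dens
  exact ⟨K, hK, fun n hn i => h _ (ratio_pos hn i) _ (H.abs_relTruth_le i)⟩

lemma exists_tailSum_le {w : Weight J₀} (hw : w.Admissible) {δ : ℝ} (hδ : 0 < δ) {A : ℝ≥0∞}
    (hA : A ≠ ∞) {η : ℝ≥0∞} (hη : 0 < η) :
    ∃ s : Finset (Index J₀ K₀), tailSum w δ s * A ≤ η := by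
  have h := ENNReal.Tendsto.mul_const (tendsto_tailSum (K₀ := K₀) hw hδ) (Or.inr hA)
  rw [zero_mul] at h
  exact (h.eventually (ge_mem_nhds hη)).exists

lemma tendsto_measure_lt_abs {X : Type*} [MeasurableSpace X] (μ : Measure X) [IsFiniteMeasure μ]
    {F : ℕ → X → ℝ} (hF : ∀ n, Measurable (F n)) (h : ∀ x, Tendsto (fun n => F n x) atTop (𝓝 0))
    {ε : ℝ} (hε : 0 < ε) : Tendsto (fun n => μ {x | ε < |F n x|}) atTop (𝓝 0) := by
  have h1 := tendstoInMeasure_iff_dist.1 (tendstoInMeasure_of_tendsto_ae (μ := μ)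
    (fun n => (hF n).aestronglyMeasurable) (ae_of_all _ h)) ε hε
  refine tendsto_of_tendsto_of_tendsto_of_le_of_le tendsto_const_nhds h1 (fun _ => zero_le)
    fun n => measure_mono fun x hx => ?_
  have hx' : ε < |F n x| := hx
  change ε ≤ dist (F n x) 0
  rw [Real.dist_eq, sub_zero]
  exact hx'.le

/-- Convergence in probability of the rescaled posterior to the law of the white noise. The distance
only has to equal `ρ n g` almost surely, so that `ρ` may be written in terms of the posterior, which
is a product measure only for almost all data. -/
theorem tendsto_measure_blDist_localLaw {M τ b : ℝ} (H : Compatible φ α f₀ M τ b)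
    {w : Weight J₀} (hw : w.Admissible) {ρ : ℕ → (Index J₀ K₀ → ℝ) → ℝ}
    (hρ : ∀ n ≥ 1, ∀ [∀ i : Index J₀ K₀, IsMarkovKernel
      (localPost (φ.scaled (priorScale α (level i))) (noiseLevel n))], ∀ᵐ g ∂whiteNoise J₀ K₀,
      (∀ᵐ z ∂localLaw φ α n (f₀ + noiseLevel n • g), z ∈ M0Submodule K₀ w) ∧
      ρ n g = blDist ((localLaw φ α n (f₀ + noiseLevel n • g)).map (toM0 w))
        ((whiteNoise J₀ K₀).map (toM0 w))) {ε : ℝ} (hε : 0 < ε) :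
    Tendsto (fun n => whiteNoise J₀ K₀ {g | ε < ρ n g}) atTop (𝓝 0) := by
  obtain ⟨K, hK, hKle⟩ := H.exists_expMoment_le
  set G := ∫⁻ z, ENNReal.ofReal (Real.exp (z ^ 2 / 4)) ∂gaussianReal 0 1 with hG
  have hGtop : G ≠ ∞ := lintegral_exp_sq_div_four_gaussianReal_ne_top
  -- the four terms of `blDist_localLaw_le` will add up to `7 δ`
  set δ := ε / 16 with hδdef
  have hδ : 0 < δ := by positivity
  have hδ0 : ENNReal.ofReal δ ≠ 0 := (ENNReal.ofReal_pos.2 hδ).ne'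
  refine ENNReal.tendsto_atTop_zero.2 fun η hη => ?_
  -- `s` makes the white noise tail at most `δ` and the posterior tail, on average, `δ η / 2`
  obtain ⟨s, hs⟩ := exists_tailSum_le (K₀ := K₀) hw hδ (A := G + K)
    (ENNReal.add_ne_top.2 ⟨hGtop, hK⟩)
    (η := min (ENNReal.ofReal δ) (ENNReal.ofReal δ * (η / 2)))
    (lt_min (ENNReal.ofReal_pos.2 hδ)
      (ENNReal.mul_pos hδ0 (ENNReal.half_pos hη.ne').ne'))
  have hsG : tailSum w δ s * G ≤ ENNReal.ofReal δ :=
    ((mul_le_mul_right le_self_add _).trans hs).trans (min_le_left _ _)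
  have hsK : tailSum w δ s * K ≤ ENNReal.ofReal δ * (η / 2) :=
    ((mul_le_mul_right le_add_self _).trans hs).trans (min_le_right _ _)
  have hdens := tendsto_measure_lt_abs (whiteNoise J₀ K₀)
    (fun n => (measurable_densityError φ α f₀ n s).ennreal_toReal)
    (fun g => by
      simpa [Function.comp_def] using
        (ENNReal.tendsto_toReal ENNReal.zero_ne_top).comp (tendsto_densityError H s g)) hδ
  obtain ⟨N, hN⟩ := ENNReal.tendsto_atTop_zero.1 hdens (η / 2) (ENNReal.half_pos hη.ne')
  refine ⟨max N 1, fun n hn => ?_⟩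
  have hn1 : 1 ≤ n := (le_max_right _ _).trans hn
  have hmk : ∀ i : Index J₀ K₀, IsMarkovKernel
      (localPost (φ.scaled (priorScale α (level i))) (noiseLevel n)) := H.isMarkovKernel hn1
  have hnoise : (whiteNoise J₀ K₀).real (tailSet w s δ) ≤ δ := by
    refine ENNReal.toReal_le_of_le_ofReal hδ.le (le_trans ?_ hsG)
    rw [tailSum, ← ENNReal.tsum_mul_right]
    exact infinitePi_tailSet_le (fun _ : Index J₀ K₀ => gaussianReal 0 1) s hδ.le
  have hsub : ({g | ε < ρ n g} : Set (Index J₀ K₀ → ℝ)) ≤ᵐ[whiteNoise J₀ K₀]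
      ({g | ENNReal.ofReal δ ≤ tailBound φ α f₀ w n s δ g} ∪
        {g | δ < |(densityError φ α f₀ n s g).toReal|} : Set (Index J₀ K₀ → ℝ)) := by
    filter_upwards [hρ n hn1] with g hg hgε
    by_contra hcon
    have hc1 : tailBound φ α f₀ w n s δ g < ENNReal.ofReal δ :=
      not_le.1 fun h => hcon (Or.inl h)
    have hc2 : |(densityError φ α f₀ n s g).toReal| ≤ δ := not_lt.1 fun h => hcon (Or.inr h)
    rw [abs_of_nonneg ENNReal.toReal_nonneg] at hc2
    have h1 : (localLaw φ α n (f₀ + noiseLevel n • g)).real (tailSet w s δ) ≤ δ :=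
      ENNReal.toReal_le_of_le_ofReal hδ.le ((localLaw_tailSet_le w g s hδ.le).trans hc1.le)
    have h2 := blDist_localLaw_le hw hg.1 s hδ.le
    rw [← hg.2] at h2
    have h3 : ε < ρ n g := hgε
    linarith
  refine (measure_mono_ae hsub).trans ((measure_union_le _ _).trans ?_)
  rw [← ENNReal.add_halves η]
  refine add_le_add ?_ (hN n ((le_max_left _ _).trans hn))
  refine (meas_ge_le_lintegral_div (measurable_tailBound φ α f₀ w n s δ).aemeasurable hδ0
    ENNReal.ofReal_ne_top).trans (ENNReal.div_le_of_le_mul' ?_)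
  exact (lintegral_tailBound_le w s δ (hKle n hn1)).trans hsK

/-- Uniform smallness of the biases of all coefficients, relative to the weights: finitely many of
them tend to zero, and the others are controlled by `exp_bias_sq_le` and a union bound. -/
theorem tendsto_measure_exists_lt_abs_bias {M τ b : ℝ} (H : Compatible φ α f₀ M τ b)
    {w : Weight J₀} (hw : w.Admissible) {δ : ℝ} (hδ : 0 < δ) :
    Tendsto (fun n => whiteNoise J₀ K₀ {g | ∃ i, δ * w (level i) <
      |φ.bias (ratio α n i) (relTruth α f₀ i) (g i)|}) atTop (𝓝 0) := by
  obtain ⟨K, hK, hKle⟩ := H.exists_expMoment_le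
  refine ENNReal.tendsto_atTop_zero.2 fun η hη => ?_
  obtain ⟨s, hs⟩ := exists_tailSum_le (K₀ := K₀) hw hδ hK (ENNReal.half_pos hη.ne')
  have hfin : Tendsto (fun n => ∑ i ∈ s, whiteNoise J₀ K₀ {g | δ * w (level i) <
      |φ.bias (ratio α n i) (relTruth α f₀ i) (g i)|}) atTop (𝓝 (∑ _ ∈ s, 0)) := by
    refine tendsto_finsetSum _ fun i _ => ?_
    exact tendsto_measure_lt_abs (whiteNoise J₀ K₀)
      (fun n => (φ.measurable_bias (ratio α n i) (relTruth α f₀ i)).comp (measurable_pi_apply i))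
      (fun g => SubGaussianDensity.tendsto_bias (H.continuousAt i) (tendsto_ratio α i)
        (H.dens_pos i) (g i)) (mul_pos hδ (w.pos i))
  rw [Finset.sum_const_zero] at hfin
  obtain ⟨N, hN⟩ := ENNReal.tendsto_atTop_zero.1 hfin (η / 2) (ENNReal.half_pos hη.ne')
  refine ⟨max N 1, fun n hn => ?_⟩
  have hn1 : 1 ≤ n := (le_max_right _ _).trans hn
  have hsub : {g | ∃ i, δ * w (level i) < |φ.bias (ratio α n i) (relTruth α f₀ i) (g i)|} ⊆
      (⋃ i ∈ s, {g : Index J₀ K₀ → ℝ | δ * w (level i) <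
        |φ.bias (ratio α n i) (relTruth α f₀ i) (g i)|}) ∪
      {g | (1 : ℝ≥0∞) ≤ tailBound φ α f₀ w n s δ g} := by
    rintro g ⟨i, hi⟩
    by_cases his : i ∈ s
    · exact Or.inl (Set.mem_biUnion his hi)
    · refine Or.inr ?_
      -- a bias beyond `δ w_l` makes the corresponding term of `tailBound` at least `1`
      refine le_trans ?_ (ENNReal.le_tsum (⟨i, his⟩ : {i // i ∉ s}))
      have h1 := φ.exp_bias_sq_le (H.norming_ne_zero hn1 i (g i))
      refine le_trans ?_ (mul_le_mul_right h1 _)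
      rw [← ENNReal.ofReal_mul (Real.exp_pos _).le, ← Real.exp_add, ← ENNReal.ofReal_one]
      refine ENNReal.ofReal_le_ofReal (Real.one_le_exp ?_)
      have h2 := pow_le_pow_left₀ (mul_nonneg hδ.le (w.pos i).le) hi.le 2
      rw [sq_abs] at h2
      linarith [mul_pow δ (w (level i)) 2]
  refine (measure_mono hsub).trans ((measure_union_le _ _).trans ?_)
  rw [← ENNReal.add_halves η]
  refine add_le_add ((measure_biUnion_finset_le _ _).trans (hN n ((le_max_left _ _).trans hn))) ?_
  refine (meas_ge_le_lintegral_div (measurable_tailBound φ α f₀ w n s δ).aemeasurable one_ne_zero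
    ENNReal.one_ne_top).trans ?_
  rw [div_one]
  exact (lintegral_tailBound_le w s δ (hKle n hn1)).trans hs

end Convergence

/-! ### From the noise variable to the posterior -/

section Transfer

variable {J₀ K₀ : ℕ}

/-- The observation as a function of the noise. -/
def observe (n : ℕ) (hn : 1 ≤ n) (f₀ : Index J₀ K₀ → ℝ) :
    (Index J₀ K₀ → ℝ) ≃ᵐ (Index J₀ K₀ → ℝ) where
  toFun g := f₀ + noiseLevel n • g
  invFun x := √(n : ℝ) • (x - f₀)
  left_inv g := by
    simp only [add_sub_cancel_left, smul_smul, sqrt_mul_noiseLevel hn, one_smul]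
  right_inv x := by
    simp only [smul_smul, mul_comm (noiseLevel n), sqrt_mul_noiseLevel hn, one_smul]
    exact add_sub_cancel f₀ x
  measurable_toFun := by
    change Measurable fun g : Index J₀ K₀ → ℝ => f₀ + noiseLevel n • g
    fun_prop
  measurable_invFun := by
    change Measurable fun x : Index J₀ K₀ → ℝ => √(n : ℝ) • (x - f₀)
    fun_prop

/-- Probabilities under `P^n_f`, also of sets that are not known to be measurable, are
probabilities under the law of the noise. -/
lemma model_apply_set {n : ℕ} (hn : 1 ≤ n) (f₀ : Index J₀ K₀ → ℝ) (A : Set (Index J₀ K₀ → ℝ)) :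
    model J₀ K₀ n f₀ A = whiteNoise J₀ K₀ {g | f₀ + noiseLevel n • g ∈ A} := by
  rw [model_apply]
  exact (observe n hn f₀).map_apply A

lemma ae_noise_of_ae_model {n : ℕ} {f₀ : Index J₀ K₀ → ℝ} {p : (Index J₀ K₀ → ℝ) → Prop}
    (h : ∀ᵐ x ∂model J₀ K₀ n f₀, p x) :
    ∀ᵐ g ∂whiteNoise J₀ K₀, p (f₀ + noiseLevel n • g) := by
  rw [model_apply] at h
  exact ae_of_ae_map (by fun_prop) h

variable {φ : SubGaussianDensity} {α : ℝ} {f₀ : Index J₀ K₀ → ℝ} {w : Weight J₀} {n : ℕ}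

section Localization

variable [∀ i : Index J₀ K₀, IsMarkovKernel
  (localPost (φ.scaled (priorScale α (level i))) (noiseLevel n))] {x : Index J₀ K₀ → ℝ}

lemma ae_localLaw_mem (hn : 1 ≤ n)
    (hpost : post (prior J₀ K₀ α φ) n x = (localLaw φ α n x).map fun z => x + noiseLevel n • z)
    (hsq : ∫⁻ f, sqNorm f ∂post (prior J₀ K₀ α φ) n x ≠ ∞) (hx : x ∈ M0Submodule K₀ w) :
    ∀ᵐ z ∂localLaw φ α n x, x + noiseLevel n • z ∈ M0Submodule K₀ w ∧ z ∈ M0Submodule K₀ w := by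
  have h1 := ae_summable_sq hsq
  rw [hpost] at h1
  filter_upwards [ae_of_ae_map (by fun_prop) h1] with z hz
  have h2 : x + noiseLevel n • z ∈ M0Submodule K₀ w := mem_M0Submodule_of_summable_sq hz
  refine ⟨h2, ?_⟩
  have h3 := Submodule.smul_mem _ √(n : ℝ) (Submodule.sub_mem _ h2 hx)
  rwa [add_sub_cancel_left, smul_smul, sqrt_mul_noiseLevel hn, one_smul] at h3

/-- The posterior centred at the observation and rescaled by `√n` has the law `localLaw`. -/
lemma map_postM0_eq (hn : 1 ≤ n)
    (hpost : post (prior J₀ K₀ α φ) n x = (localLaw φ α n x).map fun z => x + noiseLevel n • z)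
    (hsq : ∫⁻ f, sqNorm f ∂post (prior J₀ K₀ α φ) n x ≠ ∞) (hx : x ∈ M0Submodule K₀ w) :
    (postM0 (prior J₀ K₀ α φ) w n x).map (fun f => √(n : ℝ) • (f - toM0 w x)) =
      (localLaw φ α n x).map (toM0 w) := by
  have hc : Measurable fun f : M0 K₀ w => √(n : ℝ) • (f - toM0 w x) :=
    (by fun_prop : Continuous fun f : M0 K₀ w => √(n : ℝ) • (f - toM0 w x)).measurable
  rw [postM0, hpost, Measure.map_map measurable_toM0 (by fun_prop),
    Measure.map_map hc (measurable_toM0.comp (by fun_prop))]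
  refine Measure.map_congr ?_
  filter_upwards [ae_localLaw_mem hn hpost hsq hx] with z hz
  rw [Function.comp_apply, Function.comp_apply, ← toM0_smul_sub hz.1 hx, add_sub_cancel_left,
    smul_smul, sqrt_mul_noiseLevel hn, one_smul]

/-- The posterior mean differs from the observation by the bias, in units of the noise level. -/
lemma coeff_postMean {g : Index J₀ K₀ → ℝ} (hgx : x = f₀ + noiseLevel n • g)
    (hpost : post (prior J₀ K₀ α φ) n x = (localLaw φ α n x).map fun z => x + noiseLevel n • z)
    (hsq : ∫⁻ f, sqNorm f ∂post (prior J₀ K₀ α φ) n x ≠ ∞)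
    (i : Index J₀ K₀) :
    (postMean (prior J₀ K₀ α φ) w n x).coeff i =
      x i + noiseLevel n * φ.bias (ratio α n i) (relTruth α f₀ i) (g i) := by
  have hxi : x i = f₀ i + noiseLevel n * g i := by rw [hgx]; rfl
  have hm := φ.measurable_stdDensity_right (ratio α n i) (relTruth α f₀ i) (g i)
  have hlp := localPost_scaled_apply φ α f₀ n i (g i)
  have huniv : ∫⁻ z, φ.stdDensity (ratio α n i) (relTruth α f₀ i) (g i) z
      ∂gaussianReal 0 1 = 1 := by
    have := measure_univ
      (μ := localPost (φ.scaled (priorScale α (level i))) (noiseLevel n) (x i))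
    rwa [hxi, hlp, withDensity_apply _ MeasurableSet.univ, Measure.restrict_univ] at this
  have hfin := ae_lt_top hm (by rw [huniv]; exact ENNReal.one_ne_top)
  have h1 : ∫ z, z ∂localPost (φ.scaled (priorScale α (level i))) (noiseLevel n) (x i) =
      φ.bias (ratio α n i) (relTruth α f₀ i) (g i) := by
    rw [hxi, hlp, integral_withDensity_eq_integral_toReal_smul hm hfin]
    simp only [SubGaussianDensity.bias, smul_eq_mul, mul_comm]
  have hint : Integrable (fun z : ℝ => z)
      (localPost (φ.scaled (priorScale α (level i))) (noiseLevel n) (x i)) := by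
    rw [hxi, hlp, integrable_withDensity_iff hm hfin]
    exact φ.integrable_mul_stdDensity _ _ _ SubGaussianDensity.integrable_id_gaussianReal
  have h2 : Integrable (fun f => f) (postM0 (prior J₀ K₀ α φ) w n x) := integrable_id_map_toM0 hsq
  have h3 := ae_summable_sq hsq
  have hev : Measurable fun f : Index J₀ K₀ → ℝ => f i := measurable_pi_apply i
  rw [← coeffCLM_apply, postMean, ← ContinuousLinearMap.integral_comp_comm _ h2, postM0,
    integral_map measurable_toM0.aemeasurable
      (coeffCLM w i).continuous.aestronglyMeasurable]
  have h4 : ∫ f, coeffCLM w i (toM0 w f) ∂post (prior J₀ K₀ α φ) n x =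
      ∫ f, f i ∂post (prior J₀ K₀ α φ) n x := by
    refine integral_congr_ae ?_
    filter_upwards [h3] with f hf
    rw [coeffCLM_apply, coeff_toM0 (mem_M0Submodule_of_summable_sq hf)]
  rw [h4, hpost, integral_map (by fun_prop) hev.aestronglyMeasurable]
  have h5 : (localLaw φ α n x).map (fun z => z i) =
      localPost (φ.scaled (priorScale α (level i))) (noiseLevel n) (x i) :=
    Measure.infinitePi_map_eval _ i
  have h6 : ∫ z, (x i + noiseLevel n * z i) ∂localLaw φ α n x =
      ∫ z, (x i + noiseLevel n * z) ∂localPost (φ.scaled (priorScale α (level i)))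
        (noiseLevel n) (x i) := by
    rw [← h5, integral_map (measurable_pi_apply i).aemeasurable
      (by fun_prop : Measurable fun z : ℝ => x i + noiseLevel n * z).aestronglyMeasurable]
  simp only [Pi.add_apply, Pi.smul_apply, smul_eq_mul]
  rw [h6, integral_add (integrable_const _) (hint.const_mul _), integral_const_mul, h1]
  simp

end Localization

/-- Almost every observation is regular: the posterior is the product of the posteriors of the
coefficients, has a second moment in `ℓ²`, and the observation lies in `M₀(w)`. -/
lemma ae_noise_regular {M τ b : ℝ} (H : Compatible φ α f₀ M τ b) (hα : 0 < α)
    (hf₀ : Summable fun i => f₀ i ^ 2) (hw : w.Admissible) (hn : 1 ≤ n)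
    [∀ i : Index J₀ K₀, IsMarkovKernel
      (localPost (φ.scaled (priorScale α (level i))) (noiseLevel n))] :
    ∀ᵐ g ∂whiteNoise J₀ K₀,
      (post (prior J₀ K₀ α φ) n (f₀ + noiseLevel n • g) =
        (localLaw φ α n (f₀ + noiseLevel n • g)).map
          fun z => (f₀ + noiseLevel n • g) + noiseLevel n • z) ∧
      ∫⁻ f, sqNorm f ∂post (prior J₀ K₀ α φ) n (f₀ + noiseLevel n • g) ≠ ∞ ∧
      f₀ + noiseLevel n • g ∈ M0Submodule K₀ w := by
  have hac := model_absolutelyContinuous_marginal φ hα hn hf₀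
  filter_upwards [ae_noise_of_ae_model (hac.ae_le
      (ae_post_eq_map_localLaw α H.b_pos (H.M_pos.trans H.lt) H.le_dens hn)),
    ae_noise_of_ae_model (hac.ae_le (ae_lintegral_sqNorm_post_ne_top φ hα)),
    ae_whiteNoise_mem hw] with g h1 h2 h3
  exact ⟨h1, h2, Submodule.add_mem _ (mem_M0Submodule_of_summable_sq hf₀)
    (Submodule.smul_mem _ _ h3)⟩

lemma tendsto_noise_blDist_observation {M τ b : ℝ} (H : Compatible φ α f₀ M τ b) (hα : 0 < α)
    (hf₀ : Summable fun i => f₀ i ^ 2) (hw : w.Admissible) {ε : ℝ} (hε : 0 < ε) :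
    Tendsto (fun n => whiteNoise J₀ K₀ {g | ε < blDist
      ((postM0 (prior J₀ K₀ α φ) w n (f₀ + noiseLevel n • g)).map
        fun f => √(n : ℝ) • (f - toM0 w (f₀ + noiseLevel n • g)))
      ((whiteNoise J₀ K₀).map (toM0 w))}) atTop (𝓝 0) := by
  refine tendsto_measure_blDist_localLaw H hw (fun n hn => ?_) hε
  intro _
  filter_upwards [ae_noise_regular H hα hf₀ hw hn] with g hg
  refine ⟨?_, ?_⟩
  · filter_upwards [ae_localLaw_mem hn hg.1 hg.2.1 hg.2.2] with z hz using hz.2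
  · rw [map_postM0_eq hn hg.1 hg.2.1 hg.2.2]

theorem weakBvM_observation {M τ b : ℝ} (H : Compatible φ α f₀ M τ b) (hα : 0 < α)
    (hf₀ : Summable fun i => f₀ i ^ 2) (hw : w.Admissible) :
    WeakBvM (prior J₀ K₀ α φ) w f₀ (fun _ x => toM0 w x) ((whiteNoise J₀ K₀).map (toM0 w)) := by
  intro ε hε
  refine (tendsto_noise_blDist_observation H hα hf₀ hw hε).congr' ?_
  filter_upwards [eventually_ge_atTop 1] with n hn
  rw [model_apply_set hn]
  rfl

/-- The posterior mean is within `o(1 / √n)` of the observation, which permits to change the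
centring. -/
theorem weakBvM_postMean {M τ b : ℝ} (H : Compatible φ α f₀ M τ b) (hα : 0 < α)
    (hf₀ : Summable fun i => f₀ i ^ 2) (hw : w.Admissible) :
    WeakBvM (prior J₀ K₀ α φ) w f₀ (postMean (prior J₀ K₀ α φ) w)
      ((whiteNoise J₀ K₀).map (toM0 w)) := by
  intro ε hε
  have h1 := (tendsto_noise_blDist_observation H hα hf₀ hw (half_pos hε)).add
    (tendsto_measure_exists_lt_abs_bias H hw (half_pos hε))
  rw [add_zero] at h1
  refine tendsto_of_tendsto_of_tendsto_of_le_of_le' tendsto_const_nhds h1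
    (Eventually.of_forall fun _ => zero_le) ?_
  filter_upwards [eventually_ge_atTop 1] with n hn
  have hmk : ∀ i : Index J₀ K₀, IsMarkovKernel
      (localPost (φ.scaled (priorScale α (level i))) (noiseLevel n)) := H.isMarkovKernel hn
  rw [model_apply_set hn]
  refine (measure_mono_ae ?_).trans (measure_union_le _ _)
  filter_upwards [ae_noise_regular H hα hf₀ hw hn] with g hg hgε
  set x := f₀ + noiseLevel n • g with hx
  by_contra hcon
  have hc1 : blDist ((postM0 (prior J₀ K₀ α φ) w n x).map fun f => √(n : ℝ) • (f - toM0 w x))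
      ((whiteNoise J₀ K₀).map (toM0 w)) ≤ ε / 2 := not_lt.1 fun h => hcon (Or.inl h)
  have hc2 : ∀ i, |φ.bias (ratio α n i) (relTruth α f₀ i) (g i)| ≤ ε / 2 * w (level i) :=
    fun i => not_lt.1 fun h => hcon (Or.inr ⟨i, h⟩)
  have hgε' : ε < blDist ((postM0 (prior J₀ K₀ α φ) w n x).map
      fun f => √(n : ℝ) • (f - postMean (prior J₀ K₀ α φ) w n x))
      ((whiteNoise J₀ K₀).map (toM0 w)) := hgε
  set m := postMean (prior J₀ K₀ α φ) w n x with hm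
  have hnorm : ‖√(n : ℝ) • (toM0 w x - m)‖ ≤ ε / 2 := by
    refine M0.norm_le (half_pos hε).le fun i => ?_
    rw [M0.coeff_smul, M0.coeff_sub, coeff_toM0 hg.2.2, hm, coeff_postMean hx hg.1 hg.2.1,
      sub_add_cancel_left, mul_neg, abs_neg, ← mul_assoc, sqrt_mul_noiseLevel hn, one_mul]
    exact hc2 i
  have : IsProbabilityMeasure (postM0 (prior J₀ K₀ α φ) w n x) :=
    Measure.isProbabilityMeasure_map measurable_toM0.aemeasurable
  have : IsProbabilityMeasure ((whiteNoise J₀ K₀).map (toM0 w)) :=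
    Measure.isProbabilityMeasure_map measurable_toM0.aemeasurable
  have hc : Measurable fun f : M0 K₀ w => √(n : ℝ) • (f - toM0 w x) :=
    (by fun_prop : Continuous fun f : M0 K₀ w => √(n : ℝ) • (f - toM0 w x)).measurable
  have hadd : Measurable fun f : M0 K₀ w => f + √(n : ℝ) • (toM0 w x - m) :=
    (continuous_add_const _).measurable
  have : IsProbabilityMeasure ((postM0 (prior J₀ K₀ α φ) w n x).map
      fun f => √(n : ℝ) • (f - toM0 w x)) := Measure.isProbabilityMeasure_map hc.aemeasurable
  have hshift := blDist_map_add_le ((postM0 (prior J₀ K₀ α φ) w n x).map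
    fun f => √(n : ℝ) • (f - toM0 w x)) ((whiteNoise J₀ K₀).map (toM0 w))
    (√(n : ℝ) • (toM0 w x - m))
  rw [Measure.map_map hadd hc] at hshift
  have heq : ((fun f : M0 K₀ w => f + √(n : ℝ) • (toM0 w x - m)) ∘
      fun f => √(n : ℝ) • (f - toM0 w x)) = fun f => √(n : ℝ) • (f - m) := by
    funext f
    rw [Function.comp_apply, ← smul_add]
    congr 1
    abel
  rw [heq] at hshift
  linarith

end Transfer

end Multiscale

end

theorem theorem2 {J₀ K₀ : ℕ}
    (ψ : HilbertBasis (Index J₀ K₀) ℝ (Lp ℝ 2 (volume : Measure unitInterval)))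
    (φ : SubGaussianDensity) (α : ℝ) (hα : 0 < α)
    (β : ℝ) (hβ : 0 < β) (f₀ : C(unitInterval, ℝ)) (hf₀ : f₀ ∈ HolderType ψ β)
    (M : ℝ) (hM : 0 < M)
    (hP1 : ∀ i, |coeffs ψ f₀ i| / priorScale α (level i) ≤ M)
    (τ cφ : ℝ) (hτ : M < τ) (hcφ : 0 < cφ)
    (hP2 : ContinuousOn φ (Set.Ioo (-τ) τ) ∧ ∀ x ∈ Set.Ioo (-τ) τ, cφ ≤ φ x)
    (w : Weight J₀) (hw : w.Admissible) :
    -- the white noise, the posterior and its mean are well defined in `M₀(w)`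
    (∀ᵐ g ∂(whiteNoise J₀ K₀), g ∈ M0Submodule K₀ w) ∧
    (∀ n : ℕ, 1 ≤ n → ∀ᵐ x ∂(model J₀ K₀ n (coeffs ψ f₀)),
      (∀ᵐ f ∂(post (prior J₀ K₀ α φ) n x), Memℓp f 2) ∧
      Integrable (fun f => f) (postM0 (prior J₀ K₀ α φ) w n x)) ∧
    -- centring at the observation
    WeakBvM (prior J₀ K₀ α φ) w (coeffs ψ f₀) (fun _ x => toM0 w x)
      ((whiteNoise J₀ K₀).map (toM0 w)) ∧
    -- centring at the posterior mean
    WeakBvM (prior J₀ K₀ α φ) w (coeffs ψ f₀) (postMean (prior J₀ K₀ α φ) w)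
      ((whiteNoise J₀ K₀).map (toM0 w)) := by
  have hsum : Summable fun i => coeffs ψ f₀ i ^ 2 := by
    have h := ψ.orthonormal.inner_products_summable (𝕜 := ℝ)
      (ContinuousMap.toLp 2 (volume : Measure unitInterval) ℝ f₀)
    simpa [coeffs] using h
  have H : Compatible φ α (coeffs ψ f₀) M τ cφ :=
    { M_pos := hM
      lt := hτ
      b_pos := hcφ
      cont := hP2.1
      le_dens := hP2.2
      abs_relTruth_le := fun i => by
        rw [relTruth, abs_div, abs_of_pos (priorScale_pos α _)]
        exact hP1 i }
  refine ⟨ae_whiteNoise_mem hw, fun n hn => ?_, weakBvM_observation H hα hsum hw,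
    weakBvM_postMean H hα hsum hw⟩
  filter_upwards [(model_absolutelyContinuous_marginal φ hα hn hsum).ae_le
    (ae_lintegral_sqNorm_post_ne_top φ hα)] with x hx
  refine ⟨?_, integrable_id_map_toM0 hx⟩
  filter_upwards [ae_summable_sq hx] with f hf using memℓp_two_of_summable_sq hf
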